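/- Let $K\ge 1$, $l\ge 1$ be integers and let $P_i=(p_{i1},\dots,p_{il})$, $i=1,\dots,K$, be probability distributions on $\{x_1,\dots,x_l\}$. Put $c_i=\sum_{j=1}^l\sqrt{p_{ij}(1-p_{ij})}$, $C_{\ell_1}=\big(\sum_{k=1}^K c_k^2\big)^{1/2}$, $\lambda_i=c_i^2/C_{\ell_1}^2$, $\lambda_{\min}=\min_i\lambda_i$, $\lambda_{\max}=\max_i\lambda_i$, and assume $\lambda_{\min}>0$. Let $n\ge K$ be the sampling budget, $\delta=1/n$, and $\delta_t=3\delta/(Kl\pi^2t^2)$ for $t\ge1$. The scheme $\mathcal A_{\ell_1}$ samples each $P_i$ once in rounds $1,\dots,K$; in every round $t$ with $K<t\le n$ it samples from a $P_i$ that maximises $u_{i,t}/\sqrt{T_{i,t}}$ (ties broken by any function of the history), where $T_{i,t}$ is the number of samples taken from $P_i$ before round $t$, $\hat p_{ij,t}$ is the fraction of them equal to $x_j$, and $$u_{i,t}=\sum_{j=1}^l\sqrt{\hat p_{ij,t}(1-\hat p_{ij,t})}+\sqrt{\frac{2l^2\log(2/\delta_t)}{T_{i,t}}} .$$ All samples are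 independent. Let $\hat P_i$ be the empirical distribution of the samples taken from $P_i$ in the $n$ rounds, let $D_{\ell_1}(P,Q)=\sum_{j}|p_j-q_j|$, and let $\mathcal L_n(\mathcal A_{\ell_1},D_{\ell_1})=\max_i\mathbb E[D_{\ell_1}(\hat P_i,P_i)]$ be the risk. For an integer $T\ge1$ let $\gamma_i(T)$ be the expected $\ell_1$-distance between $P_i$ and the empirical distribution of $T$ independent samples from $P_i$, and extend $\gamma_i$ in any way to a nonincreasing function of real $T>0$. The oracle risk is $\mathcal L_n^*=\inf\{\max_i\gamma_i(T_i): T_i>0\text{ real},\ \sum_{i=1}^K T_i=n\}$, and the regret is $\mathcal R_n(\mathcal A_{\ell_1},D_{\ell_1})=\mathcal L_n(\mathcal A_{\ell_1},D_{\ell_1})-\mathcal L_n^*$. Finally put $$M_{\ell_1}=\frac{2l\,\lambda_{\max}\sqrt{\log(1/\delta_n)}}{C_{\ell_1}\lambda_{\min}} .$$ Then for every $n\ge K$ with $n\ge 6(K-1)M_{\ell_1}^2/\lambda_{\min}^3$, $$\mathcal R_n(\mathcal A_{\ell_1},D_{\ell_1})\ \le\ \frac{l\sqrt{(K+5)M_{\ell_1}}}{2\,\lambda_{\min}\,n^{3/4}}+\tilde{\mathcal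 O}(1/n),$$ where the last term is at most $C(\log n)^k/n$ with constants $C$ and $k$ that depend only on $K$, $l$ and a positive lower bound on $\lambda_{\min}$ (not on $n$ nor otherwise on the $P_i$). -/

import Mathlib

open MeasureTheory ProbabilityTheory

noncomputable section

namespace AllocL1

/-- The `ℓ1` distance `∑ j, |p j - q j|` of two vectors indexed by `Fin l`. -/
def distL1 {l : ℕ} (p q : Fin l → ℝ) : ℝ := ∑ j, |p j - q j|

/-- The parameter `c = ∑ j, √(p j (1 - p j))` of a distribution `p` on `Fin l`. -/
def cParam {l : ℕ} (p : Fin l → ℝ) : ℝ := ∑ j, √(p j * (1 - p j))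

/-- The approximate objective function `φ(c, T) = c / √T`. -/
def phi (c T : ℝ) : ℝ := c / √T

/-- `C_{ℓ1}`, the nonnegative root of `∑ i, (c i) ^ 2`. -/
def cNorm {K l : ℕ} (p : Fin K → Fin l → ℝ) : ℝ := √(∑ i, cParam (p i) ^ 2)

/-- `λ i = (c i)² / ∑ k, (c k)²`: the approximate oracle gives `λ i * n` samples to arm `i`. -/
def lam {K l : ℕ} (p : Fin K → Fin l → ℝ) (i : Fin K) : ℝ :=
  cParam (p i) ^ 2 / cNorm p ^ 2

/-- The smallest `λ i`. -/
def lamMin {K l : ℕ} (p : Fin K → Fin l → ℝ) : ℝ := ⨅ i, lam p i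

/-- The largest `λ i`. -/
def lamMax {K l : ℕ} (p : Fin K → Fin l → ℝ) : ℝ := ⨆ i, lam p i

/-- The confidence level `δ_t = 3 δ / (K l π² t²)` of round `t` (rounds are counted from `1`). -/
def deltaAt (K l : ℕ) (δ : ℝ) (t : ℕ) : ℝ := 3 * δ / (K * l * Real.pi ^ 2 * (t : ℝ) ^ 2)

/-- `M = 2 l λ_max √(log (1 / δ_n)) / (C_{ℓ1} λ_min)`. -/
def mConst {K l : ℕ} (p : Fin K → Fin l → ℝ) (n : ℕ) (δ : ℝ) : ℝ :=
  2 * l * lamMax p * √(Real.log (1 / deltaAt K l δ n)) / (cNorm p * lamMin p)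

/-- A history: the pairs (arm pulled, symbol observed) so far, most recent first. -/
abbrev History (K l : ℕ) : Type := List (Fin K × Fin l)

/-- An adaptive allocation scheme: from the budget and the history of the first `t - 1` rounds it
selects the arm to be pulled in round `t`. -/
abbrev Scheme (K l : ℕ) : Type := ℕ → History K l → Fin K

/-- `T_{i,t}`: the number of pulls of arm `i` in a history. -/
def pulls {K l : ℕ} (h : History K l) (i : Fin K) : ℕ := h.countP (fun a => a.1 = i)

/-- The empirical distribution of arm `i` in a history (only meaningful once `i` was pulled). -/
def empirical {K l : ℕ} (h : History K l) (i : Fin K) (j : Fin l) : ℝ :=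
  (h.count (i, j) : ℝ) / (pulls h i : ℝ)

/-- The optimistic estimate `u_{i,t} = ∑ j, √(p̂_{ij,t} (1 - p̂_{ij,t})) + √(2 l² log(2/δ_t) / T_{i,t})`
before round `t = h.length + 1`. -/
def ucb {K l : ℕ} (δ : ℝ) (h : History K l) (i : Fin K) : ℝ :=
  cParam (empirical h i)
    + √(2 * (l : ℝ) ^ 2 * Real.log (2 / deltaAt K l δ (h.length + 1)) / (pulls h i : ℝ))

/-- The optimistic tracking algorithm with budget `n` and confidence parameter `δ`: every arm is
pulled once in the first `K` rounds, and in each later round an arm maximising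
`φ(u_{i,t}, T_{i,t})` is pulled (ties are broken in any way that depends on the history). -/
def IsOptimisticTracking {K l : ℕ} (π : Scheme K l) (n : ℕ) (δ : ℝ) : Prop :=
  ∀ h : History K l, h.length < n →
    (h.length < K → (π n h : ℕ) = h.length) ∧
    (K ≤ h.length →
      ∀ i, phi (ucb δ h i) (pulls h i) ≤ phi (ucb δ h (π n h)) (pulls h (π n h)))

/-- `X i s` is the `(s+1)`-st draw from arm `i`: all draws are independent, and the draws from arm
`i` have the distribution `p i`. -/
structure IsSampling {K l : ℕ} {Ω : Type*} [MeasurableSpace Ω] (μ : Measure Ω)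
    (p : Fin K → Fin l → ℝ) (X : Fin K → ℕ → Ω → Fin l) : Prop where
  measurable : ∀ i s, Measurable (X i s)
  indep : iIndepFun (fun (a : Fin K × ℕ) => X a.1 a.2) μ
  law : ∀ i s j, μ.real (X i s ⁻¹' {j}) = p i j

/-- The history after `t` rounds when the scheme `π` is run with budget `n`. A pull of an arm
reveals the next unused draw of that arm. -/
def run {K l : ℕ} {Ω : Type*} (π : Scheme K l) (n : ℕ) (X : Fin K → ℕ → Ω → Fin l) (ω : Ω) :
    ℕ → History K l
  | 0 => []
  | t + 1 =>
    let h := run π n X ω t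
    (π n h, X (π n h) (pulls h (π n h)) ω) :: h

/-- The risk `max_i 𝔼[D_{ℓ1}(P̂_i, P_i)]` after the budget `n` is used up. -/
def risk {K l : ℕ} {Ω : Type*} [MeasurableSpace Ω] (μ : Measure Ω) (p : Fin K → Fin l → ℝ)
    (X : Fin K → ℕ → Ω → Fin l) (π : Scheme K l) (n : ℕ) : ℝ :=
  ⨆ i, ∫ ω, distL1 (empirical (run π n X ω n) i) (p i) ∂μ

/-- The exact objective `γ_i(T) = 𝔼[D_{ℓ1}(P̂_i, P_i)]`, with `P̂_i` the empirical distribution of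
the first `T ≥ 1` draws from arm `i`. -/
def gam {K l : ℕ} {Ω : Type*} [MeasurableSpace Ω] (μ : Measure Ω) (p : Fin K → Fin l → ℝ)
    (X : Fin K → ℕ → Ω → Fin l) (i : Fin K) (T : ℕ) : ℝ :=
  ∫ ω, distL1 (fun j => (((Finset.range T).filter (fun s => X i s ω = j)).card : ℝ) / (T : ℝ))
    (p i) ∂μ

/-- `g` extends the objectives `γ_i`, which are given for integers `T ≥ 1`, to real `T > 0` as
nonincreasing functions. -/
def IsObjectiveExtension {K : ℕ} (γ : Fin K → ℕ → ℝ) (g : Fin K → ℝ → ℝ) : Prop :=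
  ∀ i, AntitoneOn (g i) (Set.Ioi 0) ∧ ∀ T : ℕ, 1 ≤ T → g i T = γ i T

/-- The risk of the (non-integer) oracle allocation: the minimum of `max_i g_i(T_i)` over all real
allocations `T_i > 0` with `∑ i, T_i = n`. -/
def oracleRisk {K : ℕ} (g : Fin K → ℝ → ℝ) (n : ℕ) : ℝ :=
  ⨅ T : {T : Fin K → ℝ // (∀ i, 0 < T i) ∧ ∑ i, T i = (n : ℝ)}, ⨆ i, g i (T.1 i)

/-- The regret with respect to the oracle allocation. -/
def regret {K l : ℕ} {Ω : Type*} [MeasurableSpace Ω] (μ : Measure Ω) (p : Fin K → Fin l → ℝ)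
    (X : Fin K → ℕ → Ω → Fin l) (g : Fin K → ℝ → ℝ) (π : Scheme K l) (n : ℕ) : ℝ :=
  risk μ p X π n - oracleRisk g n

end AllocL1

end

noncomputable section

namespace AllocL1

/-! ### The Stein equation of the absolute value -/

/-! The regret is in fact at most a constant times `log n / n`, so the nonnegative `n ^ (-3/4)` term
is only added at the end. The gain comes from knowing the objective `γ_i` to second order. Stein's
method shows that a sum `S_T` of centred independent variables bounded by 1, with variance `v`,
satisfies `𝔼|S_T| = √(2/π) √(T v) + O(1)`, with an error bounded uniformly in `T` and `v`
(`IsCentredSeq.abs_integral_abs_sum_sub_le`). Hence `γ_i(T) = √(2/π) c_i / √T + O(1/T)`. Since `c_i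
= C √λ_i` and `∑ λ_i = 1`, every allocation leaves some arm with at most `λ_i n` samples, and the
oracle risk is at least `√(2/π) C / √n - O(1/n)` (`IsSampling.le_oracleRisk`).

For the algorithm, Bernstein's inequality gives an event of probability `1 - O(1/n)` on which all
estimates of `c_i` are accurate to `O(√(log n / T_i))`. Comparing indices at the last pull of an arm
that has received its share yields `c_i / √T_i ≤ C / √n + O(√(log n) / n)` for all arms
(`IsOptimisticTracking.allocation_bounds`), and hence deterministic bounds `m' ≤ T_i ≤ m` that are
close to `λ_i n` when the excess is small relative to `C / √n`.

The number of pulls is random and depends on the draws. On the good event the distance is at most `∑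
|S_{T_i}| / m'`, and optional stopping for the submartingale `|S|` replaces `T_i` by `m` in
expectation (`IsSampling.integral_abs_stopped_le`). Stein's estimate at `m` then matches the leading
term of the oracle risk.

Uniformity is delicate because a lower bound on `λ_min` does not keep `C` away from 0. No constant
may contain `1 / C`, and the case where `C / √n` is itself of the order of the error is treated
separately. -/

lemma nonneg_of_hasDerivAt_nonpos_of_tendsto {H H' : ℝ → ℝ} {b : ℝ}
    (hd : ∀ x, b ≤ x → HasDerivAt H (H' x) x) (hn : ∀ x, b ≤ x → H' x ≤ 0)
    (ht : Filter.Tendsto H Filter.atTop (nhds 0)) {x : ℝ} (hx : b ≤ x) : 0 ≤ H x := by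
  have hanti : AntitoneOn H (Set.Ici b) := by
    apply antitoneOn_of_deriv_nonpos (convex_Ici b)
    · exact fun y hy => (hd y hy).continuousAt.continuousWithinAt
    · intro y hy
      rw [interior_Ici] at hy
      exact (hd y (le_of_lt hy)).differentiableAt.differentiableWithinAt
    · intro y hy
      rw [interior_Ici] at hy
      rw [(hd y (le_of_lt hy)).deriv]
      exact hn y (le_of_lt hy)
  refine le_of_tendsto ht ?_
  filter_upwards [Filter.eventually_ge_atTop x] with y hy
  exact hanti hx (hx.trans hy) hy

/-- The tail `∫_x^∞ exp (-t ^ 2 / 2) dt` of the Gaussian integral. -/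
def gaussTail (x : ℝ) : ℝ := √(Real.pi / 2) - ∫ t in (0 : ℝ)..x, Real.exp (-(t ^ 2 / 2))

lemma hasDerivAt_gaussTail (x : ℝ) : HasDerivAt gaussTail (-Real.exp (-(x ^ 2 / 2))) x := by
  have hc : Continuous fun t : ℝ => Real.exp (-(t ^ 2 / 2)) := by fun_prop
  exact (intervalIntegral.integral_hasDerivAt_right (hc.intervalIntegrable _ _)
    (hc.stronglyMeasurableAtFilter _ _) hc.continuousAt).const_sub _

lemma tendsto_gaussTail : Filter.Tendsto gaussTail Filter.atTop (nhds 0) := by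
  have h1 : (fun t : ℝ => Real.exp (-(t ^ 2 / 2))) = fun t => Real.exp (-(1 / 2) * t ^ 2) := by
    ext t; ring_nf
  have h2 := intervalIntegral_tendsto_integral_Ioi (μ := volume) (0 : ℝ)
    (integrable_exp_neg_mul_sq (b := 1 / 2) (by norm_num)).integrableOn Filter.tendsto_id
  rw [integral_gaussian_Ioi] at h2
  have h3 : √(Real.pi / (1 / 2)) / 2 = √(Real.pi / 2) := by
    rw [show Real.pi / (1 / 2) = (Real.pi / 2) * 2 ^ 2 by ring, Real.sqrt_mul (by positivity),
      Real.sqrt_sq (by norm_num)]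
    ring
  rw [h3] at h2
  have h4 := h2.const_sub (√(Real.pi / 2))
  rw [sub_self] at h4
  refine h4.congr fun x => ?_
  simp only [gaussTail, h1, id]

lemma tendsto_exp_neg_sq_div_two :
    Filter.Tendsto (fun x : ℝ => Real.exp (-(x ^ 2 / 2))) Filter.atTop (nhds 0) := by
  refine Real.tendsto_exp_neg_atTop_nhds_zero.comp ?_
  exact (Filter.tendsto_pow_atTop (by norm_num)).atTop_div_const (by norm_num)

lemma hasDerivAt_exp_neg_sq_div_two (x : ℝ) :
    HasDerivAt (fun x : ℝ => Real.exp (-(x ^ 2 / 2))) (-x * Real.exp (-(x ^ 2 / 2))) x := by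
  have h := (((hasDerivAt_pow 2 x).div_const 2).fun_neg).exp
  convert h using 1
  norm_num
  ring

lemma gaussTail_nonneg (x : ℝ) : 0 ≤ gaussTail x :=
  nonneg_of_hasDerivAt_nonpos_of_tendsto (fun y _ => hasDerivAt_gaussTail y)
    (fun y _ => by simpa using (Real.exp_pos _).le) tendsto_gaussTail le_rfl

lemma gaussTail_zero : gaussTail 0 = √(Real.pi / 2) := by simp [gaussTail]

lemma gaussTail_le_sqrt {x : ℝ} (hx : 0 ≤ x) : gaussTail x ≤ √(Real.pi / 2) := by
  have : 0 ≤ ∫ t in (0 : ℝ)..x, Real.exp (-(t ^ 2 / 2)) :=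
    intervalIntegral.integral_nonneg hx fun t _ => (Real.exp_pos _).le
  simpa [gaussTail] using this

/-- The difference of the two sides tends to 0 and has derivative `-exp (-x²/2) / x²`. The lower
bound `le_gaussTail` follows the same pattern. -/
lemma gaussTail_le_div {x : ℝ} (hx : 1 ≤ x) : gaussTail x ≤ Real.exp (-(x ^ 2 / 2)) / x := by
  rw [← sub_nonneg]
  refine nonneg_of_hasDerivAt_nonpos_of_tendsto
    (H := fun x => Real.exp (-(x ^ 2 / 2)) / x - gaussTail x)
    (H' := fun x => -(Real.exp (-(x ^ 2 / 2)) / x ^ 2)) (b := 1) (fun y hy => ?_) (fun y _ => ?_)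
    ?_ hx
  · have hy0 : y ≠ 0 := by positivity
    refine HasDerivAt.congr_deriv
      (((hasDerivAt_exp_neg_sq_div_two y).fun_div (hasDerivAt_id' y) hy0).fun_sub
      (hasDerivAt_gaussTail y)) ?_
    field_simp
    ring
  · have := (Real.exp_pos (-(y ^ 2 / 2))).le
    simp only [Left.neg_nonpos_iff]
    positivity
  · simpa using (tendsto_exp_neg_sq_div_two.div_atTop Filter.tendsto_id).sub tendsto_gaussTail

lemma le_gaussTail {x : ℝ} (hx : 0 ≤ x) :
    x / (1 + x ^ 2) * Real.exp (-(x ^ 2 / 2)) ≤ gaussTail x := by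
  rw [← sub_nonneg]
  refine nonneg_of_hasDerivAt_nonpos_of_tendsto
    (H := fun x => gaussTail x - x / (1 + x ^ 2) * Real.exp (-(x ^ 2 / 2)))
    (H' := fun x => -(2 / (1 + x ^ 2) ^ 2 * Real.exp (-(x ^ 2 / 2)))) (b := 0)
    (fun y hy => ?_) (fun y _ => ?_) ?_ hx
  · have hy0 : 1 + y ^ 2 ≠ 0 := by positivity
    refine HasDerivAt.congr_deriv ((hasDerivAt_gaussTail y).fun_sub ((((hasDerivAt_id' y).fun_div
      ((hasDerivAt_pow 2 y).const_add 1) hy0)).fun_mul (hasDerivAt_exp_neg_sq_div_two y))) ?_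
    field_simp
    norm_num
    ring
  · have := (Real.exp_pos (-(y ^ 2 / 2))).le
    simp only [Left.neg_nonpos_iff]
    positivity
  · have h : Filter.Tendsto (fun x : ℝ => x / (1 + x ^ 2) * Real.exp (-(x ^ 2 / 2)))
        Filter.atTop (nhds 0) := by
      refine squeeze_zero' (g := fun x : ℝ => Real.exp (-(x ^ 2 / 2))) ?_ ?_
        tendsto_exp_neg_sq_div_two
      · filter_upwards [Filter.eventually_ge_atTop 0] with y hy
        positivity
      · refine Filter.Eventually.of_forall fun y => mul_le_of_le_one_left (Real.exp_pos _).le ?_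
        rw [div_le_one (by positivity)]
        nlinarith [sq_nonneg (y - 1)]
    simpa using tendsto_gaussTail.sub h

/-- The Mills ratio of the Gaussian density. -/
def mills (x : ℝ) : ℝ := Real.exp (x ^ 2 / 2) * gaussTail x

lemma hasDerivAt_mills (x : ℝ) : HasDerivAt mills (x * mills x - 1) x := by
  have h1 : HasDerivAt (fun x : ℝ => Real.exp (x ^ 2 / 2)) (Real.exp (x ^ 2 / 2) * x) x := by
    have h := ((hasDerivAt_pow 2 x).div_const 2).exp
    convert h using 1
    norm_num
  refine HasDerivAt.congr_deriv (h1.fun_mul (hasDerivAt_gaussTail x)) ?_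
  have : Real.exp (x ^ 2 / 2) * Real.exp (-(x ^ 2 / 2)) = 1 := by rw [← Real.exp_add]; simp
  simp only [mills, mul_neg, this]
  ring

/-- The bounded expression is the derivative of `x * mills x - 1`, so this controls the second
derivative of the Stein solution. Nonnegativity is `le_gaussTail`. For `x ≥ 1` the tail bound leaves
at most `1 / x`, and on `[0, 1]` the crude bound of the tail suffices. -/
lemma exists_mills_bound : ∃ L : ℝ, 0 ≤ L ∧ ∀ x, 0 ≤ x → |(1 + x ^ 2) * mills x - x| ≤ L := by
  refine ⟨2 * (Real.exp (1 / 2) * √(Real.pi / 2)) + 1, by positivity, fun x hx => ?_⟩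
  have hE := Real.exp_pos (x ^ 2 / 2)
  have hprod : Real.exp (x ^ 2 / 2) * Real.exp (-(x ^ 2 / 2)) = 1 := by
    rw [← Real.exp_add]; simp
  have hlow : 0 ≤ (1 + x ^ 2) * mills x - x := by
    have h := mul_le_mul_of_nonneg_left (le_gaussTail hx) hE.le
    have h2 : Real.exp (x ^ 2 / 2) * (x / (1 + x ^ 2) * Real.exp (-(x ^ 2 / 2)))
        = x / (1 + x ^ 2) := by
      rw [mul_left_comm, hprod, mul_one]
    rw [h2, div_le_iff₀ (by positivity)] at h
    change 0 ≤ (1 + x ^ 2) * (Real.exp (x ^ 2 / 2) * gaussTail x) - x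
    linarith
  rw [abs_of_nonneg hlow]
  rcases le_total x 1 with h1 | h1
  · have hm : mills x ≤ Real.exp (1 / 2) * √(Real.pi / 2) := by
      unfold mills
      have : Real.exp (x ^ 2 / 2) ≤ Real.exp (1 / 2) := Real.exp_le_exp.2 (by nlinarith)
      exact mul_le_mul this (gaussTail_le_sqrt hx) (gaussTail_nonneg x) (Real.exp_pos _).le
    have hm0 : 0 ≤ mills x := mul_nonneg hE.le (gaussTail_nonneg x)
    have : (1 + x ^ 2) * mills x ≤ 2 * mills x :=
      mul_le_mul_of_nonneg_right (by nlinarith) hm0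
    linarith
  · have hm : mills x ≤ 1 / x := by
      have h := mul_le_mul_of_nonneg_left (gaussTail_le_div h1) hE.le
      rw [← mul_div_assoc, hprod] at h
      exact h
    have hx0 : 0 < x := by linarith
    have : (1 + x ^ 2) * mills x ≤ (1 + x ^ 2) * (1 / x) :=
      mul_le_mul_of_nonneg_left hm (by positivity)
    have h3 : (1 + x ^ 2) * (1 / x) = 1 / x + x := by field_simp
    have h4 : 1 / x ≤ 1 := by rw [div_le_one hx0]; exact h1
    have : 0 ≤ Real.exp (1 / 2) * √(Real.pi / 2) := by positivity
    linarith

/-- The constant `√(2 / π) = 𝔼 |N(0, 1)|`. -/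
def gaussMean : ℝ := (√(Real.pi / 2))⁻¹

lemma gaussMean_pos : 0 < gaussMean := by unfold gaussMean; positivity

/-- The derivative of the solution of the Stein equation of the absolute value. -/
def steinDeriv (x : ℝ) : ℝ := gaussMean * (|x| * mills |x| - 1)

/-- The solution of the Stein equation `f' x - x * f x = |x| - √(2 / π)`. -/
def steinSol (x : ℝ) : ℝ := ∫ u in (0 : ℝ)..x, steinDeriv u

lemma continuous_steinDeriv : Continuous steinDeriv := by
  have h : Continuous mills :=
    continuous_iff_continuousAt.2 fun x => (hasDerivAt_mills x).continuousAt
  unfold steinDeriv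
  fun_prop

lemma hasDerivAt_steinSol (x : ℝ) : HasDerivAt steinSol (steinDeriv x) x :=
  intervalIntegral.integral_hasDerivAt_right (continuous_steinDeriv.intervalIntegrable _ _)
    (continuous_steinDeriv.stronglyMeasurableAtFilter _ _) continuous_steinDeriv.continuousAt

lemma steinDeriv_neg (x : ℝ) : steinDeriv (-x) = steinDeriv x := by simp [steinDeriv]

lemma steinSol_neg (x : ℝ) : steinSol (-x) = -steinSol x := by
  unfold steinSol
  have h := intervalIntegral.integral_comp_neg (a := 0) (b := x) steinDeriv
  simp only [steinDeriv_neg, neg_zero] at h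
  rw [h, intervalIntegral.integral_symm]

/-- On the half-line the solution is `gaussMean * mills x - 1`. The value of `gaussMean` is the one
that makes it vanish at 0, so that it extends to an odd function and the equation carries over to
negative `x`. -/
lemma stein_equation_of_nonneg {x : ℝ} (hx : 0 ≤ x) :
    steinDeriv x - x * steinSol x = |x| - gaussMean := by
  have h : steinSol x = gaussMean * mills x - gaussMean * mills 0 := by
    unfold steinSol
    have h1 : ∫ u in (0 : ℝ)..x, steinDeriv u
        = ∫ u in (0 : ℝ)..x, gaussMean * (u * mills u - 1) := by
      apply intervalIntegral.integral_congr
      intro u hu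
      rw [Set.uIcc_of_le hx] at hu
      simp [steinDeriv, abs_of_nonneg hu.1]
    rw [h1]
    apply intervalIntegral.integral_eq_sub_of_hasDerivAt
    · exact fun u _ => (hasDerivAt_mills u).const_mul _
    · have h : Continuous mills :=
        continuous_iff_continuousAt.2 fun x => (hasDerivAt_mills x).continuousAt
      exact Continuous.intervalIntegrable (by fun_prop) _ _
  have h0 : gaussMean * mills 0 = 1 := by
    have : √(Real.pi / 2) ≠ 0 := by positivity
    simp only [mills, gaussTail_zero, gaussMean]
    have h2 : √Real.pi ≠ 0 := by positivity
    norm_num [this, h2]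
  rw [h, h0, steinDeriv, abs_of_nonneg hx]
  ring

lemma stein_equation (x : ℝ) : steinDeriv x - x * steinSol x = |x| - gaussMean := by
  rcases le_total 0 x with h | h
  · exact stein_equation_of_nonneg h
  · have := stein_equation_of_nonneg (x := -x) (by linarith)
    rw [steinDeriv_neg, steinSol_neg, abs_neg] at this
    linarith

/-- Only a Lipschitz bound is claimed, because `|x|` may produce a kink at 0. The mean value
inequality on the half-line is transported by `||y| - |x|| ≤ |y - x|`. -/
lemma exists_steinDeriv_lipschitz :
    ∃ L : ℝ, 0 ≤ L ∧ ∀ x y, |steinDeriv y - steinDeriv x| ≤ L * |y - x| := by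
  obtain ⟨L, hL, hb⟩ := exists_mills_bound
  have hg := gaussMean_pos
  refine ⟨gaussMean * L, by positivity, fun x y => ?_⟩
  have key : ∀ x y : ℝ, 0 ≤ x → 0 ≤ y →
      ‖gaussMean * (y * mills y - 1) - gaussMean * (x * mills x - 1)‖
        ≤ gaussMean * L * ‖y - x‖ := by
    intro x y hx hy
    refine (convex_Ici (0 : ℝ)).norm_image_sub_le_of_norm_hasDerivWithin_le
      (f := fun x => gaussMean * (x * mills x - 1))
      (f' := fun x => gaussMean * ((1 + x ^ 2) * mills x - x)) (fun z _ => ?_) (fun z hz => ?_)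
      hx hy
    · refine HasDerivAt.hasDerivWithinAt ?_
      refine HasDerivAt.congr_deriv
        ((((hasDerivAt_id' z).fun_mul (hasDerivAt_mills z)).sub_const 1).const_mul gaussMean) ?_
      ring
    · rw [norm_mul, Real.norm_of_nonneg hg.le]
      exact mul_le_mul_of_nonneg_left (hb z hz) hg.le
  refine (key |x| |y| (abs_nonneg _) (abs_nonneg _)).trans ?_
  exact mul_le_mul_of_nonneg_left (abs_abs_sub_abs_le y x) (by positivity)

lemma steinSol_taylor {L : ℝ} (hL : ∀ x y, |steinDeriv y - steinDeriv x| ≤ L * |y - x|)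
    (hL0 : 0 ≤ L) (w y : ℝ) :
    |steinSol (w + y) - steinSol w - y * steinDeriv w| ≤ L * y ^ 2 := by
  have h := (convex_uIcc w (w + y)).norm_image_sub_le_of_norm_hasDerivWithin_le
    (f := fun x => steinSol x - x * steinDeriv w) (f' := fun x => steinDeriv x - steinDeriv w)
    (C := L * |y|) (x := w) (y := w + y) (fun z _ => ?_) (fun z hz => ?_) Set.left_mem_uIcc
    Set.right_mem_uIcc
  · simp only [Real.norm_eq_abs, add_sub_cancel_left] at h
    rw [mul_assoc, abs_mul_abs_self, ← sq] at h
    convert h using 2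
    ring
  · refine HasDerivAt.hasDerivWithinAt ?_
    simpa using (hasDerivAt_steinSol z).fun_sub ((hasDerivAt_id' z).mul_const (steinDeriv w))
  · refine (hL w z).trans (mul_le_mul_of_nonneg_left ?_ hL0)
    have := Set.abs_sub_left_of_mem_uIcc hz
    simpa using this

/-! ### Sums of independent centred bounded variables -/

/-- Independent centred random variables with values in `[-1, 1]` and variance `v`. -/
structure IsCentredSeq {Ω : Type*} [MeasurableSpace Ω] (μ : Measure Ω) (Y : ℕ → Ω → ℝ)
    (v : ℝ) : Prop where
  measurable : ∀ s, Measurable (Y s)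
  indep : iIndepFun Y μ
  bound : ∀ s ω, |Y s ω| ≤ 1
  mean : ∀ s, ∫ ω, Y s ω ∂μ = 0
  var : ∀ s, ∫ ω, Y s ω ^ 2 ∂μ = v

lemma exists_bound_comp {φ : ℝ → ℝ} (hφ : Continuous φ) (R : ℝ) :
    ∃ B, ∀ x, |x| ≤ R → |φ x| ≤ B := by
  obtain ⟨B, hB⟩ := (isCompact_Icc (a := -R) (b := R)).exists_bound_of_continuousOn hφ.continuousOn
  exact ⟨B, fun x hx => hB x (abs_le.1 hx)⟩

lemma abs_sum_range_le {Ω : Type*} {Y : ℕ → Ω → ℝ} (h : ∀ s ω, |Y s ω| ≤ 1) (T : ℕ) (ω : Ω) :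
    |∑ s ∈ Finset.range T, Y s ω| ≤ T := by
  refine (Finset.abs_sum_le_sum_abs _ _).trans ?_
  refine (Finset.sum_le_sum fun s _ => h s ω).trans ?_
  simp

section

variable {Ω : Type*} [MeasurableSpace Ω] {μ : Measure Ω}

lemma abs_integral_le_of_abs_le {f g : Ω → ℝ} (hg : Integrable g μ) (h : ∀ ω, |f ω| ≤ g ω) :
    |∫ ω, f ω ∂μ| ≤ ∫ ω, g ω ∂μ :=
  norm_integral_le_of_norm_le (f := f) hg (Filter.Eventually.of_forall h)

lemma IsCentredSeq.neg {Y : ℕ → Ω → ℝ} {v : ℝ} (h : IsCentredSeq μ Y v) :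
    IsCentredSeq μ (fun s ω => -Y s ω) v where
  measurable s := (h.measurable s).neg
  indep := h.indep.comp (fun _ x => -x) fun _ => measurable_neg
  bound s ω := by simpa using h.bound s ω
  mean s := by rw [integral_neg, h.mean s, neg_zero]
  var s := by simpa using h.var s

lemma IsCentredSeq.var_nonneg {Y : ℕ → Ω → ℝ} {v : ℝ} (h : IsCentredSeq μ Y v) : 0 ≤ v := by
  rw [← h.var 0]; exact integral_nonneg fun ω => sq_nonneg _

lemma IsCentredSeq.measurable_sum {Y : ℕ → Ω → ℝ} {v : ℝ} (h : IsCentredSeq μ Y v)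
    (A : Finset ℕ) : Measurable fun ω => ∑ s ∈ A, Y s ω :=
  Finset.measurable_fun_sum A fun s _ => h.measurable s

variable [IsProbabilityMeasure μ]

lemma integrable_of_abs_le {f : Ω → ℝ} {R : ℝ} (hf : Measurable f) (h : ∀ ω, |f ω| ≤ R) :
    Integrable f μ :=
  Integrable.of_bound hf.aestronglyMeasurable R (Filter.Eventually.of_forall h)

lemma IsCentredSeq.integrable {Y : ℕ → Ω → ℝ} {v : ℝ} (h : IsCentredSeq μ Y v) (s : ℕ) :
    Integrable (Y s) μ := integrable_of_abs_le (h.measurable s) (h.bound s)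

lemma IsCentredSeq.integrable_sq {Y : ℕ → Ω → ℝ} {v : ℝ} (h : IsCentredSeq μ Y v) (s : ℕ) :
    Integrable (fun ω => Y s ω ^ 2) μ :=
  integrable_of_abs_le (R := 1) ((h.measurable s).pow_const 2) fun ω => by
    rw [abs_pow]; exact pow_le_one₀ (abs_nonneg _) (h.bound s ω)

/-- Integrate `exp z ≤ 1 + z + z²`, valid for `|z| ≤ 1`; the linear term has mean 0. -/
lemma IsCentredSeq.mgf_le {Y : ℕ → Ω → ℝ} {v : ℝ} (h : IsCentredSeq μ Y v) (s : ℕ) {t : ℝ}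
    (ht : |t| ≤ 1) : mgf (Y s) μ t ≤ Real.exp (t ^ 2 * v) := by
  have hexp : ∀ ω, Real.exp (t * Y s ω) ≤ 1 + t * Y s ω + t ^ 2 * Y s ω ^ 2 := by
    intro ω
    have hb : |t * Y s ω| ≤ 1 := by
      rw [abs_mul]; exact mul_le_one₀ ht (abs_nonneg _) (h.bound s ω)
    have := (abs_le.1 (Real.abs_exp_sub_one_sub_id_le hb)).2
    rw [mul_pow] at this
    linarith
  have hi1 : Integrable (fun ω => 1 + t * Y s ω) μ :=
    (integrable_const 1).add ((h.integrable s).const_mul t)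
  have hi2 : Integrable (fun ω => t ^ 2 * Y s ω ^ 2) μ := (h.integrable_sq s).const_mul _
  calc mgf (Y s) μ t ≤ ∫ ω, (1 + t * Y s ω + t ^ 2 * Y s ω ^ 2) ∂μ :=
        integral_mono_of_nonneg (Filter.Eventually.of_forall fun ω => (Real.exp_pos _).le)
          (hi1.add hi2) (Filter.Eventually.of_forall hexp)
    _ = 1 + t ^ 2 * v := by
        rw [integral_add hi1 hi2, integral_add (integrable_const 1) ((h.integrable s).const_mul t),
          integral_const_mul, integral_const_mul, h.mean, h.var]
        simp
    _ ≤ Real.exp (t ^ 2 * v) := by linarith [Real.add_one_le_exp (t ^ 2 * v)]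

/-- One-sided Bernstein inequality. -/
lemma IsCentredSeq.bernstein_one_sided {Y : ℕ → Ω → ℝ} {v : ℝ} (h : IsCentredSeq μ Y v) (T : ℕ)
    {L : ℝ} (hL : 0 < L) :
    μ.real {ω | 2 * √(T * v * L) + 2 * L ≤ ∑ s ∈ Finset.range T, Y s ω} ≤ Real.exp (-L) := by
  have hv := h.var_nonneg
  set w : ℝ := T * v with hw
  have hw0 : 0 ≤ w := by positivity
  have key : ∀ t : ℝ, 0 ≤ t → t ≤ 1 → ∀ ε : ℝ,
      μ.real {ω | ε ≤ ∑ s ∈ Finset.range T, Y s ω} ≤ Real.exp (-t * ε + t ^ 2 * w) := by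
    intro t ht0 ht1 ε
    have h1 := measure_ge_le_exp_mul_mgf (μ := μ) (X := fun ω => ∑ s ∈ Finset.range T, Y s ω) ε ht0
      (by
        refine integrable_of_abs_le (R := Real.exp T)
          (((h.measurable_sum _).const_mul t).exp) fun ω => ?_
        rw [Real.abs_exp, Real.exp_le_exp]
        have := abs_sum_range_le h.bound T ω
        have h2 : t * ∑ s ∈ Finset.range T, Y s ω ≤ |t| * |∑ s ∈ Finset.range T, Y s ω| := by
          rw [← abs_mul]; exact le_abs_self _
        rw [abs_of_nonneg ht0] at h2
        nlinarith [abs_nonneg (∑ s ∈ Finset.range T, Y s ω)])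
    refine h1.trans ?_
    rw [Real.exp_add]
    refine mul_le_mul_of_nonneg_left ?_ (Real.exp_pos _).le
    have h3 := h.indep.mgf_sum (t := t) h.measurable (Finset.range T)
    have h4 : (∑ s ∈ Finset.range T, Y s) = fun ω => ∑ s ∈ Finset.range T, Y s ω := by
      ext ω; simp
    rw [h4] at h3
    rw [h3]
    refine (Finset.prod_le_prod (fun s _ => mgf_nonneg) fun s _ =>
      h.mgf_le s (abs_le.2 ⟨by linarith, ht1⟩)).trans ?_
    rw [Finset.prod_const, Finset.card_range, ← Real.exp_nat_mul]
    apply le_of_eq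
    rw [hw]; ring_nf
  -- The Chernoff parameter is `min 1 √(L / w)`. The truncation at 1 is what the moment bound
  -- permits, and it accounts for the additive term `2 * L`.
  rcases le_total w L with hc | hc
  · refine (key 1 zero_le_one le_rfl _).trans (Real.exp_le_exp.2 ?_)
    have := Real.sqrt_nonneg (w * L)
    linarith
  · have hwp : 0 < w := hL.trans_le hc
    refine (key (√(L / w)) (Real.sqrt_nonneg _) ?_ _).trans (Real.exp_le_exp.2 ?_)
    · rw [Real.sqrt_le_one, div_le_one hwp]; exact hc
    · have h1 : √(L / w) * √(w * L) = L := by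
        rw [← Real.sqrt_mul (by positivity), show L / w * (w * L) = L ^ 2 by field_simp,
          Real.sqrt_sq hL.le]
      have h2 : √(L / w) ^ 2 * w = L := by
        rw [Real.sq_sqrt (by positivity)]; field_simp
      have h3 : 0 ≤ √(L / w) * L := by positivity
      nlinarith

/-- Bernstein's inequality. -/
lemma IsCentredSeq.bernstein {Y : ℕ → Ω → ℝ} {v : ℝ} (h : IsCentredSeq μ Y v) (T : ℕ)
    {L : ℝ} (hL : 0 < L) :
    μ.real {ω | 2 * √(T * v * L) + 2 * L ≤ |∑ s ∈ Finset.range T, Y s ω|}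
      ≤ 2 * Real.exp (-L) := by
  have h1 := h.bernstein_one_sided T hL
  have h2 := h.neg.bernstein_one_sided T hL
  have hsub : {ω | 2 * √(T * v * L) + 2 * L ≤ |∑ s ∈ Finset.range T, Y s ω|}
      ⊆ {ω | 2 * √(T * v * L) + 2 * L ≤ ∑ s ∈ Finset.range T, Y s ω}
        ∪ {ω | 2 * √(T * v * L) + 2 * L ≤ ∑ s ∈ Finset.range T, -Y s ω} := by
    intro ω hω
    simp only [Set.mem_ofPred_eq, Set.mem_union, Finset.sum_neg_distrib] at hω ⊢
    exact le_abs.1 hω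
  refine (measureReal_mono hsub).trans ((measureReal_union_le _ _).trans ?_)
  linarith

/-- Leave-one-out argument. With `W = S - Y s` independent of `Y s`, expand the solution around `W /
b`: the constant term has mean 0, the linear term gives `v / b` times the mean derivative at `W /
b`. The Taylor remainder and the replacement of `W` by `S` each cost `v L / b²`. -/
lemma IsCentredSeq.stein_term {Y : ℕ → Ω → ℝ} {v L b : ℝ} (h : IsCentredSeq μ Y v) (T : ℕ)
    (hL : ∀ x y, |steinDeriv y - steinDeriv x| ≤ L * |y - x|) (hL0 : 0 ≤ L) (hb : 0 < b)
    {s : ℕ} (hs : s ∈ Finset.range T) :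
    |∫ ω, Y s ω * steinSol ((∑ r ∈ Finset.range T, Y r ω) / b) ∂μ
        - v / b * ∫ ω, steinDeriv ((∑ r ∈ Finset.range T, Y r ω) / b) ∂μ|
      ≤ 2 * (v * L / b ^ 2) := by
  have hsol : Continuous steinSol :=
    continuous_iff_continuousAt.2 fun x => (hasDerivAt_steinSol x).continuousAt
  have hder := continuous_steinDeriv
  have hv := h.var_nonneg
  set S : Ω → ℝ := fun ω => ∑ r ∈ Finset.range T, Y r ω with hS
  set W : Ω → ℝ := fun ω => ∑ r ∈ (Finset.range T).erase s, Y r ω with hW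
  have hSW : ∀ ω, S ω = W ω + Y s ω := fun ω => (Finset.sum_erase_add _ _ hs).symm
  have hSm : Measurable S := h.measurable_sum _
  have hWm : Measurable W := h.measurable_sum _
  have hSb : ∀ ω, |S ω / b| ≤ T / b := fun ω => by
    rw [abs_div, abs_of_pos hb]
    exact div_le_div_of_nonneg_right (abs_sum_range_le h.bound T ω) hb.le
  have hWb : ∀ ω, |W ω / b| ≤ (T + 1) / b := fun ω => by
    rw [abs_div, abs_of_pos hb]
    refine div_le_div_of_nonneg_right ?_ hb.le
    have h1 := abs_sum_range_le h.bound T ω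
    have h2 := h.bound s ω
    have h3 : W ω = S ω - Y s ω := by rw [hSW]; ring
    rw [h3]
    exact (abs_sub _ _).trans (add_le_add h1 h2)
  obtain ⟨B1, hB1⟩ := exists_bound_comp hsol (T / b)
  obtain ⟨B2, hB2⟩ := exists_bound_comp hsol ((T + 1) / b)
  obtain ⟨B3, hB3⟩ := exists_bound_comp hder (T / b)
  obtain ⟨B4, hB4⟩ := exists_bound_comp hder ((T + 1) / b)
  have hYm := h.measurable s
  have hi1 : Integrable (fun ω => Y s ω * steinSol (S ω / b)) μ :=
    (integrable_of_abs_le (hsol.measurable.comp (hSm.div_const b))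
      fun ω => hB1 _ (hSb ω)).bdd_mul (c := 1) hYm.aestronglyMeasurable
      (Filter.Eventually.of_forall (h.bound s))
  have hi2 : Integrable (fun ω => Y s ω * steinSol (W ω / b)) μ :=
    (integrable_of_abs_le (hsol.measurable.comp (hWm.div_const b))
      fun ω => hB2 _ (hWb ω)).bdd_mul (c := 1) hYm.aestronglyMeasurable
      (Filter.Eventually.of_forall (h.bound s))
  have hi3 : Integrable (fun ω => steinDeriv (S ω / b)) μ :=
    integrable_of_abs_le (hder.measurable.comp (hSm.div_const b)) fun ω => hB3 _ (hSb ω)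
  have hi4 : Integrable (fun ω => steinDeriv (W ω / b)) μ :=
    integrable_of_abs_le (hder.measurable.comp (hWm.div_const b)) fun ω => hB4 _ (hWb ω)
  have hi5 : Integrable (fun ω => Y s ω ^ 2 * steinDeriv (W ω / b)) μ :=
    hi4.bdd_mul (c := 1) (hYm.pow_const 2).aestronglyMeasurable
      (Filter.Eventually.of_forall fun ω => by
        rw [Real.norm_eq_abs, abs_pow]; exact pow_le_one₀ (abs_nonneg _) (h.bound s ω))
  have hind : IndepFun W (Y s) μ := by
    have := h.indep.indepFun_finsetSum_of_notMem h.measurable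
      (Finset.notMem_erase s (Finset.range T))
    convert this using 1
    ext ω; simp [hW]
  have e1 : ∫ ω, Y s ω * steinSol (W ω / b) ∂μ = 0 := by
    have := (hind.symm.comp measurable_id
      (hsol.measurable.comp (measurable_id.div_const b))).integral_fun_mul_eq_mul_integral
      hYm.aestronglyMeasurable (hsol.measurable.comp (hWm.div_const b)).aestronglyMeasurable
    simp only [Function.comp_def, id] at this
    rw [this, h.mean, zero_mul]
  have e2 : ∫ ω, Y s ω ^ 2 * steinDeriv (W ω / b) ∂μ = v * ∫ ω, steinDeriv (W ω / b) ∂μ := by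
    have := (hind.symm.comp (measurable_id.pow_const 2)
      (hder.measurable.comp (measurable_id.div_const b))).integral_fun_mul_eq_mul_integral
      (hYm.pow_const 2).aestronglyMeasurable
      (hder.measurable.comp (hWm.div_const b)).aestronglyMeasurable
    simp only [Function.comp_def, id] at this
    rw [this, h.var]
  have b1 : |∫ ω, (Y s ω * steinSol (S ω / b) - Y s ω * steinSol (W ω / b)
      - 1 / b * (Y s ω ^ 2 * steinDeriv (W ω / b))) ∂μ| ≤ v * L / b ^ 2 := by
    refine (abs_integral_le_of_abs_le (g := fun ω => L / b ^ 2 * Y s ω ^ 2)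
      ((h.integrable_sq s).const_mul _) fun ω => ?_).trans (le_of_eq ?_)
    · have ht := steinSol_taylor hL hL0 (W ω / b) (Y s ω / b)
      rw [← add_div, ← hSW] at ht
      have : Y s ω * steinSol (S ω / b) - Y s ω * steinSol (W ω / b)
          - 1 / b * (Y s ω ^ 2 * steinDeriv (W ω / b))
          = Y s ω * (steinSol (S ω / b) - steinSol (W ω / b)
            - Y s ω / b * steinDeriv (W ω / b)) := by ring
      rw [this, abs_mul]
      refine (mul_le_mul (h.bound s ω) ht (abs_nonneg _) zero_le_one).trans (le_of_eq ?_)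
      rw [div_pow]; ring
    · rw [integral_const_mul, h.var]; ring
  have b2 : |∫ ω, (steinDeriv (W ω / b) - steinDeriv (S ω / b)) ∂μ| ≤ L / b := by
    refine (abs_integral_le_of_abs_le (g := fun _ => L / b) (integrable_const _)
      fun ω => ?_).trans (le_of_eq (by simp))
    refine (hL _ _).trans ?_
    rw [div_eq_mul_inv L]
    refine mul_le_mul_of_nonneg_left ?_ hL0
    rw [hSW, show W ω / b - (W ω + Y s ω) / b = -(Y s ω) / b by ring, abs_div, abs_neg,
      abs_of_pos hb, div_eq_mul_inv]
    exact mul_le_of_le_one_left (by positivity) (h.bound s ω)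
  have hi12 : Integrable (fun ω => Y s ω * steinSol (S ω / b) - Y s ω * steinSol (W ω / b)) μ :=
    hi1.sub hi2
  rw [integral_sub hi12 (hi5.const_mul _), integral_sub hi1 hi2, integral_const_mul, e1,
    e2] at b1
  rw [integral_sub hi4 hi3] at b2
  set I1 := ∫ ω, Y s ω * steinSol (S ω / b) ∂μ
  set J1 := ∫ ω, steinDeriv (W ω / b) ∂μ
  set J2 := ∫ ω, steinDeriv (S ω / b) ∂μ
  have e3 : I1 - v / b * J2 = (I1 - 0 - 1 / b * (v * J1)) + v / b * (J1 - J2) := by ring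
  have b3 : |v / b * (J1 - J2)| ≤ v * L / b ^ 2 := by
    rw [abs_mul, abs_of_nonneg (by positivity : 0 ≤ v / b)]
    refine (mul_le_mul_of_nonneg_left b2 (by positivity)).trans (le_of_eq ?_)
    field_simp
  rw [e3]
  refine (abs_add_le _ _).trans ?_
  linarith

/-- The mean absolute value of a sum of centred independent variables is that of the Gaussian with
the same variance, up to an absolute constant. -/
lemma IsCentredSeq.abs_integral_abs_sum_sub_le {Y : ℕ → Ω → ℝ} {v L : ℝ} (h : IsCentredSeq μ Y v)
    (T : ℕ) (hL : ∀ x y, |steinDeriv y - steinDeriv x| ≤ L * |y - x|) (hL0 : 0 ≤ L) :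
    |∫ ω, |∑ s ∈ Finset.range T, Y s ω| ∂μ - gaussMean * √(T * v)| ≤ 2 * L := by
  have hv := h.var_nonneg
  -- The normalisation `b = √(T v)` requires positive variance; otherwise the sum vanishes almost
  -- surely.
  rcases (by positivity : (0 : ℝ) ≤ T * v).eq_or_lt with h0 | h0
  · rw [← h0, Real.sqrt_zero, mul_zero, sub_zero]
    have hz : ∫ ω, |∑ s ∈ Finset.range T, Y s ω| ∂μ = 0 := by
      rcases mul_eq_zero.1 h0.symm with hT | hv0
      · have : T = 0 := by exact_mod_cast hT
        simp [this]
      · have hY : ∀ s, Y s =ᵐ[μ] 0 := by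
          intro s
          have h1 := h.var s
          rw [hv0, integral_eq_zero_iff_of_nonneg (fun ω => sq_nonneg _) (h.integrable_sq s)] at h1
          filter_upwards [h1] with ω hω
          simpa using hω
        have : (fun ω => |∑ s ∈ Finset.range T, Y s ω|) =ᵐ[μ] 0 := by
          filter_upwards [ae_all_iff.2 hY] with ω hω
          simp [hω]
        rw [integral_congr_ae this]; simp
    rw [hz, abs_zero]; positivity
  · set b := √(T * v) with hbdef
    have hb : 0 < b := Real.sqrt_pos.2 h0
    have hb2 : b ^ 2 = T * v := Real.sq_sqrt h0.le
    have hsol : Continuous steinSol :=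
      continuous_iff_continuousAt.2 fun x => (hasDerivAt_steinSol x).continuousAt
    have hder := continuous_steinDeriv
    have hSm : Measurable fun ω => ∑ r ∈ Finset.range T, Y r ω := h.measurable_sum _
    have hSb : ∀ ω, |(∑ r ∈ Finset.range T, Y r ω) / b| ≤ T / b := fun ω => by
      rw [abs_div, abs_of_pos hb]
      exact div_le_div_of_nonneg_right (abs_sum_range_le h.bound T ω) hb.le
    obtain ⟨B1, hB1⟩ := exists_bound_comp hsol (T / b)
    obtain ⟨B3, hB3⟩ := exists_bound_comp hder (T / b)
    have hi1 : ∀ s ∈ Finset.range T, Integrable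
        (fun ω => Y s ω * steinSol ((∑ r ∈ Finset.range T, Y r ω) / b)) μ := fun s _ =>
      (integrable_of_abs_le (hsol.measurable.comp (hSm.div_const b))
        fun ω => hB1 _ (hSb ω)).bdd_mul (c := 1) (h.measurable s).aestronglyMeasurable
        (Filter.Eventually.of_forall (h.bound s))
    have hi3 : Integrable (fun ω => steinDeriv ((∑ r ∈ Finset.range T, Y r ω) / b)) μ :=
      integrable_of_abs_le (hder.measurable.comp (hSm.div_const b)) fun ω => hB3 _ (hSb ω)
    have hsum : ∫ ω, |∑ s ∈ Finset.range T, Y s ω| ∂μ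
        = gaussMean * b + b * ∫ ω, steinDeriv ((∑ r ∈ Finset.range T, Y r ω) / b) ∂μ
          - ∑ s ∈ Finset.range T,
            ∫ ω, Y s ω * steinSol ((∑ r ∈ Finset.range T, Y r ω) / b) ∂μ := by
      rw [← integral_finsetSum _ hi1, ← integral_const_mul, ← sub_eq_zero, ← sub_eq_zero]
      rw [sub_zero, sub_eq_zero, add_sub_assoc, ← integral_sub (hi3.const_mul b)
        (integrable_finsetSum _ hi1)]
      have hc : gaussMean * b = ∫ _ω, gaussMean * b ∂μ := by simp
      have hi4 : Integrable (fun ω => b * steinDeriv ((∑ r ∈ Finset.range T, Y r ω) / b)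
          - ∑ s ∈ Finset.range T,
            Y s ω * steinSol ((∑ r ∈ Finset.range T, Y r ω) / b)) μ :=
        (hi3.const_mul b).sub (integrable_finsetSum _ hi1)
      rw [hc, ← integral_add (integrable_const _) hi4]
      refine integral_congr_ae (Filter.Eventually.of_forall fun ω => ?_)
      simp only
      rw [← Finset.sum_mul]
      have hst := stein_equation ((∑ r ∈ Finset.range T, Y r ω) / b)
      rw [abs_div, abs_of_pos hb] at hst
      set S := ∑ r ∈ Finset.range T, Y r ω
      have : |S| = b * (|S| / b) := by field_simp
      rw [this, show |S| / b = steinDeriv (S / b) - S / b * steinSol (S / b) + gaussMean by linarith]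
      field_simp
      ring
    rw [hsum]
    set J := ∫ ω, steinDeriv ((∑ r ∈ Finset.range T, Y r ω) / b) ∂μ
    -- As `b² = T v`, the term `b J` is exactly `T` copies of `v / b * J`. What remains is `T`
    -- leave-one-out errors of size `2 v L / b²`, with sum `2 L`.
    have e : gaussMean * b + b * J - ∑ s ∈ Finset.range T,
        ∫ ω, Y s ω * steinSol ((∑ r ∈ Finset.range T, Y r ω) / b) ∂μ - gaussMean * b
        = -∑ s ∈ Finset.range T,
          (∫ ω, Y s ω * steinSol ((∑ r ∈ Finset.range T, Y r ω) / b) ∂μ - v / b * J) := by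
      rw [Finset.sum_sub_distrib, Finset.sum_const, Finset.card_range, nsmul_eq_mul]
      have : (T : ℝ) * (v / b * J) = b * J := by
        rw [← mul_assoc, ← mul_div_assoc, ← hb2]; field_simp
      rw [this]; ring
    rw [e, abs_neg]
    refine (Finset.abs_sum_le_sum_abs _ _).trans
      ((Finset.sum_le_sum fun s hs => h.stein_term T hL hL0 hb hs).trans (le_of_eq ?_))
    rw [Finset.sum_const, Finset.card_range, nsmul_eq_mul, hb2]
    have hT : (T : ℝ) ≠ 0 := fun h1 => by simp [h1] at h0
    have hv0 : v ≠ 0 := fun h1 => by simp [h1] at h0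
    field_simp

end

/-! ### Histories and runs -/

lemma pulls_cons {K l : ℕ} (a : Fin K × Fin l) (h : History K l) (i : Fin K) :
    pulls (a :: h) i = pulls h i + if a.1 = i then 1 else 0 := by
  simp [pulls, List.countP_cons]

lemma sum_pulls {K l : ℕ} (h : History K l) : ∑ i, pulls h i = h.length := by
  induction h with
  | nil => simp [pulls]
  | cons a h ih => simp [pulls_cons, Finset.sum_add_distrib, ih]

lemma pulls_le_length {K l : ℕ} (h : History K l) (i : Fin K) : pulls h i ≤ h.length := by
  rw [← sum_pulls h]
  exact Finset.single_le_sum (f := pulls h) (fun _ _ => Nat.zero_le _) (Finset.mem_univ i)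

section

variable {K l : ℕ} {Ω : Type*} (π : Scheme K l) (n : ℕ) (X : Fin K → ℕ → Ω → Fin l) (ω : Ω)

@[simp] lemma length_run (t : ℕ) : (run π n X ω t).length = t := by
  induction t with
  | zero => rfl
  | succ t ih => simp [run, ih]

lemma pulls_run_succ (t : ℕ) (i : Fin K) :
    pulls (run π n X ω (t + 1)) i
      = pulls (run π n X ω t) i + if π n (run π n X ω t) = i then 1 else 0 := by
  simp [run, pulls_cons]

lemma pulls_run_mono (i : Fin K) : Monotone fun t => pulls (run π n X ω t) i :=
  monotone_nat_of_le_succ fun t => by rw [pulls_run_succ]; exact Nat.le_add_right _ _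

lemma pulls_run_le (t : ℕ) (i : Fin K) : pulls (run π n X ω t) i ≤ t := by
  simpa using pulls_le_length (run π n X ω t) i

lemma sum_pulls_run (t : ℕ) : ∑ i, pulls (run π n X ω t) i = t := by
  simpa using sum_pulls (run π n X ω t)

/-- Each pull reveals the next unused draw, so what has been seen of an arm is always an initial
segment of its draws. -/
lemma count_run (t : ℕ) (i : Fin K) (j : Fin l) :
    (run π n X ω t).count (i, j)
      = ((Finset.range (pulls (run π n X ω t) i)).filter (fun s => X i s ω = j)).card := by
  induction t with
  | zero => simp [run, pulls]
  | succ t ih =>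
    rw [pulls_run_succ]
    simp only [run, List.count_cons, ih]
    by_cases h : π n (run π n X ω t) = i
    · subst h
      simp only [if_true, Finset.range_add_one, Finset.filter_insert]
      split_ifs with h1 h2 h2
      · rw [Finset.card_insert_of_notMem (by simp)]
      · simp_all
      · simp_all
      · rfl
    · simp [h]

/-- The empirical distribution of the first `T` draws from arm `i`. -/
def empDraws (i : Fin K) (T : ℕ) (j : Fin l) : ℝ :=
  (((Finset.range T).filter (fun s => X i s ω = j)).card : ℝ) / (T : ℝ)

lemma empirical_run (t : ℕ) (i : Fin K) :
    empirical (run π n X ω t) i = empDraws X ω i (pulls (run π n X ω t) i) := by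
  ext j
  simp [empirical, empDraws, count_run]

/-- The run looks only at draws that it has revealed. This is the stopping time property in
deterministic form, and independence arguments rest on it. -/
lemma run_congr {Ω' : Type*} {X' : Fin K → ℕ → Ω' → Fin l} {ω' : Ω'} (t : ℕ)
    (h : ∀ k r, r < pulls (run π n X ω t) k → X k r ω = X' k r ω') :
    run π n X ω t = run π n X' ω' t := by
  induction t with
  | zero => rfl
  | succ t ih =>
    have h1 := ih fun k r hr => h k r (hr.trans_le (pulls_run_mono π n X ω k (Nat.le_succ t)))
    simp only [run]
    rw [← h1, ← h]
    rw [pulls_run_succ]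
    simp

end

/-- The table of draws that has the entries `y` in `A` and is constant elsewhere. -/
def fillIn {K l : ℕ} (x₀ : Fin l) (A : Finset (Fin K × ℕ)) (k : Fin K) (r : ℕ) (y : A → Fin l) :
    Fin l :=
  if h : (k, r) ∈ A then y ⟨(k, r), h⟩ else x₀

lemma fillIn_of_mem {K l : ℕ} (x₀ : Fin l) {A : Finset (Fin K × ℕ)} {k : Fin K} {r : ℕ}
    (h : (k, r) ∈ A) {Ω : Type*} (X : Fin K → ℕ → Ω → Fin l) (ω : Ω) :
    fillIn x₀ A k r (fun a : A => X a.1.1 a.1.2 ω) = X k r ω := by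
  simp [fillIn, h]

/-! ### Centred indicators of the draws and optional stopping -/

section

variable {K l : ℕ} {Ω : Type*} {p : Fin K → Fin l → ℝ} {X : Fin K → ℕ → Ω → Fin l}

/-- The centred indicator of symbol `j` at the draw `s` from arm `i`. -/
def centred (p : Fin K → Fin l → ℝ) (X : Fin K → ℕ → Ω → Fin l) (i : Fin K) (j : Fin l) (s : ℕ)
    (ω : Ω) : ℝ := (if X i s ω = j then 1 else 0) - p i j

lemma card_filter_sub (i : Fin K) (j : Fin l) (T : ℕ) (ω : Ω) :
    (((Finset.range T).filter (fun s => X i s ω = j)).card : ℝ) - T * p i j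
      = ∑ s ∈ Finset.range T, centred p X i j s ω := by
  simp [centred, Finset.sum_sub_distrib]

lemma empDraws_sub (i : Fin K) (j : Fin l) {T : ℕ} (hT : 1 ≤ T) (ω : Ω) :
    empDraws X ω i T j - p i j = (∑ s ∈ Finset.range T, centred p X i j s ω) / T := by
  have : (T : ℝ) ≠ 0 := by positivity
  rw [← card_filter_sub, empDraws]
  field_simp

lemma distL1_empDraws (i : Fin K) {T : ℕ} (hT : 1 ≤ T) (ω : Ω) :
    distL1 (empDraws X ω i T) (p i)
      = (∑ j, |∑ s ∈ Finset.range T, centred p X i j s ω|) / T := by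
  have : (0 : ℝ) < T := by positivity
  rw [distL1, Finset.sum_div]
  refine Finset.sum_congr rfl fun j _ => ?_
  rw [empDraws_sub i j hT, abs_div, abs_of_pos this]

variable [MeasurableSpace Ω] {μ : Measure Ω}

/-- The history is a function of the draws of index below `n`, which take values in a finite
discrete space, so any functional of it is measurable for an arbitrary scheme. -/
lemma measurable_run_comp (hX : ∀ i s, Measurable (X i s)) (π : Scheme K l) (n : ℕ)
    (F : History K l → ℝ) : Measurable fun ω => F (run π n X ω n) := by
  rcases isEmpty_or_nonempty Ω with hΩ | ⟨⟨ω₀⟩⟩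
  · exact measurable_of_empty _
  by_cases hK : K = 0
  · subst hK
    cases n with
    | zero => simp only [run]; exact measurable_const
    | succ n => exact (π 0 []).elim0
  have x₀ : Fin l := X ⟨0, Nat.pos_of_ne_zero hK⟩ 0 ω₀
  set A : Finset (Fin K × ℕ) := Finset.univ ×ˢ Finset.range n with hA
  have hrun : ∀ ω, run π n X ω n
      = run π n (fillIn x₀ A) (fun a : A => X a.1.1 a.1.2 ω) n := fun ω =>
    run_congr π n X ω n fun k r hr =>
      (fillIn_of_mem x₀ (by simpa [hA] using hr.trans_le (pulls_run_le π n X ω n k)) X ω).symm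
  simp only [hrun]
  have h1 : Measurable fun y : A → Fin l => F (run π n (fillIn x₀ A) y n) :=
    measurable_of_countable _
  exact h1.comp (measurable_pi_lambda _ fun a => hX _ _)

variable [IsProbabilityMeasure μ]

lemma IsSampling.isCentredSeq (hX : IsSampling μ p X) (i : Fin K) (j : Fin l) :
    IsCentredSeq μ (centred p X i j) (p i j * (1 - p i j)) := by
  have hf : ∀ j, Measurable fun x : Fin l => if x = j then (1 : ℝ) else 0 :=
    fun j => measurable_of_countable _
  have hm : ∀ s, Measurable (fun ω => if X i s ω = j then (1 : ℝ) else 0) :=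
    fun s => (hf j).comp (hX.measurable i s)
  have hint : ∀ s, Integrable (fun ω => if X i s ω = j then (1 : ℝ) else 0) μ :=
    fun s => integrable_of_abs_le (R := 1) (hm s) fun ω => by split_ifs <;> simp
  have hE : ∀ s, ∫ ω, (if X i s ω = j then (1 : ℝ) else 0) ∂μ = p i j := by
    intro s
    rw [← hX.law i s j, ← integral_indicator_one (hX.measurable i s (measurableSet_singleton j))]
    refine integral_congr_ae (Filter.Eventually.of_forall fun ω => ?_)
    by_cases h : X i s ω = j
    · rw [Set.indicator_of_mem (by simpa using h)]; simp [h]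
    · rw [Set.indicator_of_notMem (by simpa using h)]; simp [h]
  have hp0 : 0 ≤ p i j := by rw [← hX.law i 0 j]; exact measureReal_nonneg
  have hp1 : p i j ≤ 1 := by rw [← hX.law i 0 j]; exact measureReal_le_one
  refine ⟨fun s => (hm s).sub_const _, ?_, fun s ω => ?_, fun s => ?_, fun s => ?_⟩
  · have h1 := (hX.indep.precomp (g := fun s : ℕ => (i, s)) fun a b hab => by simpa using hab).comp
      (fun _ x => (if x = j then (1 : ℝ) else 0) - p i j) fun _ => (hf j).sub_const _
    exact h1
  · unfold centred
    split_ifs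
    · rw [abs_le]; constructor <;> linarith
    · rw [abs_le]; constructor <;> linarith
  · unfold centred
    rw [integral_sub (hint s) (integrable_const _), hE]
    simp
  · have : ∀ ω, centred p X i j s ω ^ 2
        = (1 - 2 * p i j) * (if X i s ω = j then (1 : ℝ) else 0) + p i j ^ 2 := by
      intro ω
      unfold centred
      split_ifs <;> ring
    simp only [this]
    rw [integral_add ((hint s).const_mul _) (integrable_const _), integral_const_mul, hE]
    simp
    ring

lemma IsSampling.abs_integral_dev_sub_le (hX : IsSampling μ p X) {L : ℝ}
    (hL : ∀ x y, |steinDeriv y - steinDeriv x| ≤ L * |y - x|) (hL0 : 0 ≤ L) (i : Fin K) (T : ℕ) :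
    |∑ j, ∫ ω, |∑ s ∈ Finset.range T, centred p X i j s ω| ∂μ
      - gaussMean * cParam (p i) * √T| ≤ l * (2 * L) := by
  have e : gaussMean * cParam (p i) * √T
      = ∑ j, gaussMean * √((T : ℝ) * (p i j * (1 - p i j))) := by
    rw [cParam, Finset.mul_sum, Finset.sum_mul]
    refine Finset.sum_congr rfl fun j _ => ?_
    rw [Real.sqrt_mul (Nat.cast_nonneg T)]
    ring
  rw [e, ← Finset.sum_sub_distrib]
  refine (Finset.abs_sum_le_sum_abs _ _).trans ((Finset.sum_le_sum fun j _ =>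
    (hX.isCentredSeq i j).abs_integral_abs_sum_sub_le T hL hL0).trans (by simp))

/-- The event that arm `i` is pulled exactly `s` times is independent of the draws of arm `i` from
the draw `s` on. -/
lemma IsSampling.integral_stopped_mul_eq_zero (hX : IsSampling μ p X)
    (π : Scheme K l) (n : ℕ) (i : Fin K) (j : Fin l) (s m : ℕ) :
    ∫ ω, (if pulls (run π n X ω n) i = s then
        ((SignType.sign (∑ r ∈ Finset.range s, centred p X i j r ω) : SignType) : ℝ) else 0)
      * ∑ r ∈ Finset.Ico s m, centred p X i j r ω ∂μ = 0 := by
  -- `A` holds everything a run of length `n` may read while pulling arm `i` at most `s` times; `B`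
  -- holds the later draws of arm `i`.
  set A : Finset (Fin K × ℕ) :=
    (Finset.univ ×ˢ Finset.range n).filter (fun a => ¬ (a.1 = i ∧ s ≤ a.2)) with hA
  set B : Finset (Fin K × ℕ) := {i} ×ˢ Finset.Ico s m with hB
  have hAB : Disjoint A B := by
    rw [Finset.disjoint_left]
    rintro ⟨k, r⟩ h1 h2
    simp [hA, hB] at h1 h2
    omega
  have hmemA : ∀ k r, r < n → (k = i → r < s) → (k, r) ∈ A := by
    intro k r h1 h2
    simp only [hA, Finset.mem_filter, Finset.mem_product, Finset.mem_univ, Finset.mem_range,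
      true_and, not_and, not_le]
    exact ⟨h1, h2⟩
  have hmemB : ∀ r ∈ Finset.Ico s m, (i, r) ∈ B := by
    intro r hr
    simpa [hB] using hr
  have hind := hX.indep.indepFun_finset A B hAB (fun a => hX.measurable a.1 a.2)
  let U : Ω → A → Fin l := fun ω a => X a.1.1 a.1.2 ω
  let V : Ω → B → Fin l := fun ω a => X a.1.1 a.1.2 ω
  have hU : Measurable U := measurable_pi_lambda _ fun a => hX.measurable _ _
  have hV : Measurable V := measurable_pi_lambda _ fun a => hX.measurable _ _
  let φ : (A → Fin l) → ℝ := fun y => if pulls (run π n (fillIn j A) y n) i = s then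
    ((SignType.sign (∑ r ∈ Finset.range s, centred p (fillIn j A) i j r y) : SignType) : ℝ) else 0
  let ψ : (B → Fin l) → ℝ := fun z => ∑ r ∈ Finset.Ico s m, centred p (fillIn j B) i j r z
  have hφ : Measurable φ := measurable_of_countable _
  have hψ : Measurable ψ := measurable_of_countable _
  have hrun : ∀ ω, pulls (run π n X ω n) i = s → run π n X ω n = run π n (fillIn j A) (U ω) n :=
    fun ω h => run_congr π n X ω n fun k r hr => (fillIn_of_mem j (hmemA k r
      (hr.trans_le (pulls_run_le π n X ω n k)) fun hk => by subst hk; omega) X ω).symm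
  -- Both directions are needed: together they show that the event of exactly `s` pulls is itself
  -- determined by the draws in `A`.
  have hrun' : ∀ ω, pulls (run π n (fillIn j A) (U ω) n) i = s →
      run π n (fillIn j A) (U ω) n = run π n X ω n :=
    fun ω h => run_congr π n (fillIn j A) (U ω) n fun k r hr => fillIn_of_mem j (hmemA k r
      (hr.trans_le (pulls_run_le π n _ _ n k)) fun hk => by subst hk; omega) X ω
  have e1 : ∀ ω, (if pulls (run π n X ω n) i = s then
      ((SignType.sign (∑ r ∈ Finset.range s, centred p X i j r ω) : SignType) : ℝ) else 0)
      = φ (U ω) := by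
    intro ω
    by_cases h : pulls (run π n X ω n) i = s
    · have h2 : pulls (run π n (fillIn j A) (U ω) n) i = s := by rw [← hrun ω h]; exact h
      have hs : s ≤ n := h ▸ pulls_run_le π n X ω n i
      simp only [φ, h, h2, if_true]
      congr 2
      refine Finset.sum_congr rfl fun r hr => ?_
      have hr' := Finset.mem_range.1 hr
      simp only [centred]
      rw [fillIn_of_mem j (hmemA i r (by omega) fun _ => hr') X ω]
    · have h2 : ¬ pulls (run π n (fillIn j A) (U ω) n) i = s := fun h2 =>
        h (by rw [← hrun' ω h2]; exact h2)
      simp only [φ, h, h2, if_false]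
  have e2 : ∀ ω, ∑ r ∈ Finset.Ico s m, centred p X i j r ω = ψ (V ω) := by
    intro ω
    refine Finset.sum_congr rfl fun r hr => ?_
    simp only [centred]
    rw [fillIn_of_mem j (hmemB r hr) X ω]
  have hc := hX.isCentredSeq i j
  have e3 : ∫ ω, ψ (V ω) ∂μ = 0 := by
    simp only [← e2]
    rw [integral_finsetSum _ fun r _ => hc.integrable r]
    exact Finset.sum_eq_zero fun r _ => hc.mean r
  simp only [e1, e2]
  have := (hind.comp hφ hψ).integral_fun_mul_eq_mul_integral
    (hφ.comp hU).aestronglyMeasurable (hψ.comp hV).aestronglyMeasurable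
  refine this.trans ?_
  have e4 : ∫ ω, (ψ ∘ fun ω (a : B) => X a.1.1 a.1.2 ω) ω ∂μ = 0 := e3
  rw [e4, mul_zero]

/-- Stopping the sum of the centred indicators at the number of pulls does not increase the mean
absolute value. -/
lemma IsSampling.integral_abs_stopped_le (hX : IsSampling μ p X) (π : Scheme K l) (n : ℕ)
    (i : Fin K) (j : Fin l) (m : ℕ) :
    ∫ ω, (if pulls (run π n X ω n) i ≤ m then
        |∑ r ∈ Finset.range (pulls (run π n X ω n) i), centred p X i j r ω| else 0) ∂μ
      ≤ ∫ ω, |∑ r ∈ Finset.range m, centred p X i j r ω| ∂μ := by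
  have hc := hX.isCentredSeq i j
  let S : ℕ → Ω → ℝ := fun s ω => ∑ r ∈ Finset.range s, centred p X i j r ω
  let T : Ω → ℕ := fun ω => pulls (run π n X ω n) i
  have hSm : ∀ s, Measurable (S s) := fun s => hc.measurable_sum _
  have hSb : ∀ s ω, |S s ω| ≤ s := fun s ω => abs_sum_range_le hc.bound s ω
  have hTm : ∀ s, Measurable fun ω => if T ω = s then (1 : ℝ) else 0 := fun s =>
    measurable_run_comp hX.measurable π n fun h => if pulls h i = s then (1 : ℝ) else 0
  have h1b : ∀ s ω, |if T ω = s then (1 : ℝ) else 0| ≤ 1 := fun s ω => by split_ifs <;> simp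
  have hi : ∀ s s', Integrable (fun ω => (if T ω = s then (1 : ℝ) else 0) * |S s' ω|) μ :=
    fun s s' => (integrable_of_abs_le (R := s') (hSm s').abs fun ω => by
      rw [abs_abs]; exact hSb s' ω).bdd_mul (c := 1) (hTm s).aestronglyMeasurable
        (Filter.Eventually.of_forall (h1b s))
  have hstep : ∀ s ∈ Finset.range (m + 1),
      ∫ ω, (if T ω = s then (1 : ℝ) else 0) * |S s ω| ∂μ
        ≤ ∫ ω, (if T ω = s then (1 : ℝ) else 0) * |S m ω| ∂μ := by
    intro s hs
    have hsm : s ≤ m := Nat.lt_succ_iff.1 (Finset.mem_range.1 hs)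
    have h0 := hX.integral_stopped_mul_eq_zero π n i j s m
    let D : Ω → ℝ := fun ω => ∑ r ∈ Finset.Ico s m, centred p X i j r ω
    let G : Ω → ℝ := fun ω => if T ω = s then ((SignType.sign (S s ω) : SignType) : ℝ) else 0
    have hD : ∀ ω, S s ω + D ω = S m ω := fun ω => Finset.sum_range_add_sum_Ico _ hsm
    -- Subgradient inequality for the absolute value at `S s`, restricted to `T = s`. The linear
    -- term `G * D` has mean 0.
    have hpt : ∀ ω, (if T ω = s then (1 : ℝ) else 0) * |S s ω| + G ω * D ω
        ≤ (if T ω = s then (1 : ℝ) else 0) * |S m ω| := by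
      intro ω
      by_cases h : T ω = s
      · simp only [G, h, if_true, one_mul, ← hD ω]
        rw [← sign_mul_self (S s ω), ← mul_add]
        refine (le_abs_self _).trans ?_
        rw [abs_mul]
        refine mul_le_of_le_one_left (abs_nonneg _) ?_
        rcases lt_trichotomy (S s ω) 0 with hh | hh | hh <;> simp [hh]
      · simp [G, h]
    have hGm : Measurable G := by
      have hsgn : Measurable fun x : ℝ => ((SignType.sign x : SignType) : ℝ) := by
        have : (fun x : ℝ => ((SignType.sign x : SignType) : ℝ))
            = fun x => if 0 < x then 1 else if x < 0 then -1 else 0 := by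
          ext x
          rcases lt_trichotomy x 0 with hh | hh | hh
          · simp [hh, hh.le]
          · simp [hh]
          · simp [hh]
        rw [this]
        exact Measurable.ite measurableSet_Ioi measurable_const
          (Measurable.ite measurableSet_Iio measurable_const measurable_const)
      have : G = fun ω => (if T ω = s then (1 : ℝ) else 0) * ((SignType.sign (S s ω) : SignType) : ℝ) := by
        ext ω; simp [G]
      rw [this]
      exact (hTm s).mul (hsgn.comp (hSm s))
    have hDi : Integrable D μ := integrable_finsetSum _ fun r _ => hc.integrable r
    have hGD : Integrable (fun ω => G ω * D ω) μ :=
      hDi.bdd_mul (c := 1) hGm.aestronglyMeasurable (Filter.Eventually.of_forall fun ω => by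
        simp only [G]
        split_ifs
        · rcases lt_trichotomy (S s ω) 0 with hh | hh | hh <;> simp [hh]
        · simp)
    have h2 := integral_mono ((hi s s).add hGD) (hi s m) hpt
    have h3 : ∫ ω, ((fun ω => (if T ω = s then (1 : ℝ) else 0) * |S s ω|)
        + fun ω => G ω * D ω) ω ∂μ
        = ∫ ω, (if T ω = s then (1 : ℝ) else 0) * |S s ω| ∂μ + ∫ ω, G ω * D ω ∂μ :=
      integral_add (hi s s) hGD
    have h4 : ∫ ω, G ω * D ω ∂μ = 0 := h0
    linarith
  have hdec : ∀ (ω : Ω) (f : ℕ → ℝ), (if T ω ≤ m then f (T ω) else 0)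
      = ∑ s ∈ Finset.range (m + 1), (if T ω = s then (1 : ℝ) else 0) * f s := by
    intro ω f
    simp [Finset.sum_ite_eq]
  calc ∫ ω, (if T ω ≤ m then |S (T ω) ω| else 0) ∂μ
      = ∑ s ∈ Finset.range (m + 1), ∫ ω, (if T ω = s then (1 : ℝ) else 0) * |S s ω| ∂μ := by
        rw [← integral_finsetSum _ fun s _ => hi s s]
        exact integral_congr_ae (Filter.Eventually.of_forall fun ω => hdec ω fun s => |S s ω|)
    _ ≤ ∑ s ∈ Finset.range (m + 1), ∫ ω, (if T ω = s then (1 : ℝ) else 0) * |S m ω| ∂μ :=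
        Finset.sum_le_sum hstep
    _ = ∫ ω, (if T ω ≤ m then |S m ω| else 0) ∂μ := by
        rw [← integral_finsetSum _ fun s _ => hi s m]
        exact integral_congr_ae (Filter.Eventually.of_forall fun ω =>
          (hdec ω fun _ => |S m ω|).symm)
    _ ≤ ∫ ω, |S m ω| ∂μ := by
        refine integral_mono_of_nonneg (Filter.Eventually.of_forall fun ω => ?_)
          (integrable_of_abs_le (R := m) (hSm m).abs fun ω => by rw [abs_abs]; exact hSb m ω)
          (Filter.Eventually.of_forall fun ω => ?_)
        · simp only [Pi.zero_apply]
          split_ifs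
          · exact abs_nonneg _
          · exact le_rfl
        · simp only
          split_ifs
          · exact le_rfl
          · exact abs_nonneg _

end

/-! ### Concentration of the estimated parameters -/

/-- Since `|1 - q - p| ≤ 1`, the variance changes by at most `2 σ ε + 2 ε²`, and completing the
square gives an error in the standard deviation that is uniform in `σ`, even near 0. Plain Lipschitz
continuity of the root would fail there. -/
lemma abs_sqrt_sub_sqrt_le {p q ε : ℝ} (hp0 : 0 ≤ p) (hp1 : p ≤ 1) (hq0 : 0 ≤ q) (hq1 : q ≤ 1)
    (hε : 0 ≤ ε) (h : |q - p| ≤ 2 * √(p * (1 - p)) * ε + 2 * ε ^ 2) :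
    |√(q * (1 - q)) - √(p * (1 - p))| ≤ 3 * ε := by
  have hv : 0 ≤ p * (1 - p) := mul_nonneg hp0 (by linarith)
  set σ := √(p * (1 - p)) with hσ
  have hσ0 : 0 ≤ σ := Real.sqrt_nonneg _
  have hσ2 : σ ^ 2 = p * (1 - p) := Real.sq_sqrt hv
  have hd : |q * (1 - q) - σ ^ 2| ≤ 2 * σ * ε + 2 * ε ^ 2 := by
    rw [hσ2, show q * (1 - q) - p * (1 - p) = (1 - q - p) * (q - p) by ring, abs_mul]
    refine (mul_le_of_le_one_left (abs_nonneg _) ?_).trans h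
    rw [abs_le]; constructor <;> linarith
  obtain ⟨h1, h2⟩ := abs_le.1 hd
  rw [abs_le]
  constructor
  · rcases le_total σ (3 * ε) with hc | hc
    · linarith [Real.sqrt_nonneg (q * (1 - q))]
    · have : σ - 3 * ε ≤ √(q * (1 - q)) := by
        apply Real.le_sqrt_of_sq_le
        nlinarith [mul_le_mul_of_nonneg_right hc hε]
      linarith
  · have : √(q * (1 - q)) ≤ σ + 3 * ε := by
      rw [Real.sqrt_le_left (by positivity)]
      nlinarith [mul_nonneg hσ0 hε]
    linarith

lemma cParam_nonneg {l : ℕ} (p : Fin l → ℝ) : 0 ≤ cParam p :=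
  Finset.sum_nonneg fun _ _ => Real.sqrt_nonneg _

lemma cParam_le {l : ℕ} (p : Fin l → ℝ) : cParam p ≤ l := by
  have : ∀ j ∈ Finset.univ, √(p j * (1 - p j)) ≤ 1 := fun j _ => by
    rw [Real.sqrt_le_one]; nlinarith [sq_nonneg (p j - 1 / 2)]
  refine (Finset.sum_le_sum this).trans (le_of_eq (by simp))

section

variable {K l : ℕ} {Ω : Type*} {p : Fin K → Fin l → ℝ} {X : Fin K → ℕ → Ω → Fin l}

/-- The event that all partial sums of the centred indicators up to time `n` satisfy the Bernstein
bound at the confidence level `2 / n ^ 2`. -/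
def goodEvent (p : Fin K → Fin l → ℝ) (X : Fin K → ℕ → Ω → Fin l) (n : ℕ) : Set Ω :=
  {ω | ∀ i j, ∀ s ∈ Finset.Icc 1 n, |∑ r ∈ Finset.range s, centred p X i j r ω|
    < 2 * √(s * (p i j * (1 - p i j)) * (2 * Real.log n)) + 2 * (2 * Real.log n)}

lemma empDraws_nonneg (i : Fin K) (T : ℕ) (j : Fin l) (ω : Ω) : 0 ≤ empDraws X ω i T j := by
  unfold empDraws; positivity

lemma empDraws_le_one (i : Fin K) (T : ℕ) (j : Fin l) (ω : Ω) : empDraws X ω i T j ≤ 1 := by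
  unfold empDraws
  refine div_le_one_of_le₀ ?_ (Nat.cast_nonneg _)
  exact_mod_cast (Finset.card_filter_le _ _).trans (by simp)

/-- Divided by `s`, the Bernstein bound reads `2 σ ε + 2 ε²` with `ε² = 2 log n / s`. The constant 5
rounds up `3 √2`. -/
lemma abs_cParam_empDraws_sub_le (hp0 : ∀ i j, 0 ≤ p i j) (hp1 : ∀ i j, p i j ≤ 1) {n : ℕ} {ω : Ω}
    (hω : ω ∈ goodEvent p X n) (i : Fin K) {s : ℕ} (hs1 : 1 ≤ s) (hsn : s ≤ n) :
    |cParam (empDraws X ω i s) - cParam (p i)| ≤ 5 * l * √(Real.log n) / √s := by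
  have hs : (0 : ℝ) < s := by positivity
  have hn : (1 : ℝ) ≤ n := by exact_mod_cast hs1.trans hsn
  have hlog : 0 ≤ Real.log n := Real.log_nonneg hn
  set ε := √(2 * Real.log n / s) with hε
  have hε2 : ε ^ 2 = 2 * Real.log n / s := Real.sq_sqrt (by positivity)
  have hj : ∀ j, |√(empDraws X ω i s j * (1 - empDraws X ω i s j)) - √(p i j * (1 - p i j))|
      ≤ 3 * ε := by
    intro j
    have hv : 0 ≤ p i j * (1 - p i j) := mul_nonneg (hp0 i j) (by linarith [hp1 i j])
    refine abs_sqrt_sub_sqrt_le (hp0 i j) (hp1 i j) (empDraws_nonneg i s j ω)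
      (empDraws_le_one i s j ω) (Real.sqrt_nonneg _) ?_
    rw [empDraws_sub i j hs1, abs_div, abs_of_pos hs, div_le_iff₀ hs]
    refine (hω i j s (Finset.mem_Icc.2 ⟨hs1, hsn⟩)).le.trans (le_of_eq ?_)
    have e : (s : ℝ) * (p i j * (1 - p i j)) * (2 * Real.log n)
        = (p i j * (1 - p i j)) * (2 * Real.log n / s) * s ^ 2 := by field_simp
    rw [e, Real.sqrt_mul (by positivity), Real.sqrt_sq hs.le, Real.sqrt_mul hv, ← hε, hε2]
    field_simp
  have hε' : 3 * ε ≤ 5 * √(Real.log n) / √s := by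
    rw [hε, Real.sqrt_div (by positivity), Real.sqrt_mul (by norm_num), ← mul_div_assoc]
    have h2 : √2 ≤ 5 / 3 := by rw [Real.sqrt_le_left (by norm_num)]; norm_num
    refine div_le_div_of_nonneg_right ?_ (Real.sqrt_nonneg _)
    nlinarith [Real.sqrt_nonneg (Real.log n)]
  rw [cParam, cParam, ← Finset.sum_sub_distrib]
  refine (Finset.abs_sum_le_sum_abs _ _).trans
    ((Finset.sum_le_sum fun j _ => (hj j).trans hε').trans (le_of_eq ?_))
  simp
  ring

variable [MeasurableSpace Ω] {μ : Measure Ω} [IsProbabilityMeasure μ]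

lemma IsSampling.measurableSet_goodEvent (hX : IsSampling μ p X) (n : ℕ) :
    MeasurableSet (goodEvent p X n) := by
  have : goodEvent p X n = ⋂ i, ⋂ j, ⋂ s ∈ Finset.Icc 1 n,
      {ω | |∑ r ∈ Finset.range s, centred p X i j r ω|
        < 2 * √(s * (p i j * (1 - p i j)) * (2 * Real.log n)) + 2 * (2 * Real.log n)} := by
    ext ω; simp only [goodEvent, Set.mem_ofPred_eq, Set.mem_iInter]
  rw [this]
  refine MeasurableSet.iInter fun i => MeasurableSet.iInter fun j =>
    Finset.measurableSet_biInter _ fun s _ => ?_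
  exact measurableSet_lt ((hX.isCentredSeq i j).measurable_sum _).abs measurable_const

/-- Union bound over `K l n` events, each of probability at most `2 / n²`. -/
lemma IsSampling.measureReal_compl_goodEvent_le (hX : IsSampling μ p X) {n : ℕ} (hn : 2 ≤ n) :
    μ.real (goodEvent p X n)ᶜ ≤ 2 * K * l / n := by
  have hn0 : (0 : ℝ) < n := by positivity
  have hlog : 0 < Real.log n := Real.log_pos (by exact_mod_cast hn)
  let F : Fin K × Fin l × ℕ → Set Ω := fun a =>
    {ω | 2 * √(a.2.2 * (p a.1 a.2.1 * (1 - p a.1 a.2.1)) * (2 * Real.log n)) + 2 * (2 * Real.log n)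
      ≤ |∑ r ∈ Finset.range a.2.2, centred p X a.1 a.2.1 r ω|}
  let I : Finset (Fin K × Fin l × ℕ) := Finset.univ ×ˢ Finset.univ ×ˢ Finset.Icc 1 n
  have hsub : (goodEvent p X n)ᶜ ⊆ ⋃ a ∈ I, F a := by
    intro ω hω
    simp only [goodEvent, Set.mem_compl_iff, Set.mem_ofPred_eq, not_forall, not_lt] at hω
    obtain ⟨i, j, s, hs, h⟩ := hω
    refine Set.mem_biUnion (x := (i, j, s)) ?_ h
    simpa [I] using hs
  have hE : Real.exp (-(2 * Real.log n)) = 1 / n ^ 2 := by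
    rw [Real.exp_neg, two_mul, Real.exp_add, Real.exp_log hn0]
    field_simp
  have hF : ∀ a ∈ I, μ.real (F a) ≤ 2 * (1 / n ^ 2) := fun a _ => by
    rw [← hE]
    exact (hX.isCentredSeq a.1 a.2.1).bernstein a.2.2 (by positivity)
  refine (measureReal_mono hsub (measure_ne_top _ _)).trans ((measureReal_biUnion_finset_le I F).trans
    ((Finset.sum_le_sum hF).trans (le_of_eq ?_)))
  simp only [Finset.sum_const, I, Finset.card_product, Finset.card_univ, Fintype.card_fin,
    Nat.card_Icc, nsmul_eq_mul]
  push_cast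
  simp
  field_simp

end

/-! ### The allocation of the tracking algorithm -/

section

variable {K l : ℕ} {Ω : Type*} {π : Scheme K l} {n : ℕ} {δ : ℝ}

lemma IsOptimisticTracking.pulls_run_of_le (hπ : IsOptimisticTracking π n δ) (hKn : K ≤ n)
    (X : Fin K → ℕ → Ω → Fin l) (ω : Ω) {t : ℕ} (ht : t ≤ K) (i : Fin K) :
    pulls (run π n X ω t) i = if (i : ℕ) < t then 1 else 0 := by
  induction t with
  | zero => simp [run, pulls]
  | succ t ih =>
    rw [pulls_run_succ, ih (by omega)]
    have h := (hπ (run π n X ω t) (by simp; omega)).1 (by simp; omega)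
    rw [length_run] at h
    have h2 : π n (run π n X ω t) = i ↔ t = i := by rw [Fin.ext_iff, h]
    simp only [h2]
    split_ifs <;> omega

lemma IsOptimisticTracking.one_le_pulls_run (hπ : IsOptimisticTracking π n δ) (hKn : K ≤ n)
    (X : Fin K → ℕ → Ω → Fin l) (ω : Ω) {t : ℕ} (ht : K ≤ t) (i : Fin K) :
    1 ≤ pulls (run π n X ω t) i := by
  have h1 := hπ.pulls_run_of_le hKn X ω le_rfl i
  rw [if_pos i.isLt] at h1
  rw [← h1]
  exact pulls_run_mono π n X ω i ht

/-- The last pull of an arm that was pulled at least twice. -/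
lemma IsOptimisticTracking.exists_last_pull (hπ : IsOptimisticTracking π n δ) (hKn : K ≤ n)
    (X : Fin K → ℕ → Ω → Fin l) (ω : Ω) {t : ℕ} (ht : K ≤ t) (k : Fin K)
    (hk : 2 ≤ pulls (run π n X ω t) k) :
    ∃ t', K ≤ t' ∧ t' < t ∧ π n (run π n X ω t') = k ∧
      pulls (run π n X ω t') k + 1 = pulls (run π n X ω t) k := by
  induction t, ht using Nat.le_induction with
  | base =>
    rw [hπ.pulls_run_of_le hKn X ω le_rfl] at hk
    split_ifs at hk <;> omega
  | succ t ht ih =>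
    by_cases h : π n (run π n X ω t) = k
    · exact ⟨t, ht, by omega, h, by rw [pulls_run_succ, if_pos h]⟩
    · rw [pulls_run_succ, if_neg h, add_zero] at hk ⊢
      obtain ⟨t', h1, h2, h3, h4⟩ := ih hk
      exact ⟨t', h1, by omega, h3, h4⟩

end

/-- The exploration bonus is of the order `√(log n / T)`. -/
lemma bonus_bounds {K l n t : ℕ} (hK : 1 ≤ K) (hl : 1 ≤ l) (hn : 2 ≤ n) (ht1 : 1 ≤ t)
    (htn : t ≤ n) {x : ℝ} (hx : 0 ≤ x) :
    √(Real.log n) / √x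
        ≤ √(2 * (l : ℝ) ^ 2 * Real.log (2 / deltaAt K l (1 / (n : ℝ)) t) / x) ∧
      √(2 * (l : ℝ) ^ 2 * Real.log (2 / deltaAt K l (1 / (n : ℝ)) t) / x)
        ≤ √(2 * (l : ℝ) ^ 2 * (16 * K * l + 3)) * √(Real.log n) / √x := by
  have hK' : (1 : ℝ) ≤ K := by exact_mod_cast hK
  have hl' : (1 : ℝ) ≤ l := by exact_mod_cast hl
  have hn' : (2 : ℝ) ≤ n := by exact_mod_cast hn
  have ht' : (1 : ℝ) ≤ t := by exact_mod_cast ht1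
  have htn' : (t : ℝ) ≤ n := by exact_mod_cast htn
  have hKl : (1 : ℝ) ≤ K * l := one_le_mul_of_one_le_of_one_le hK' hl'
  have hlog : 1 / 2 ≤ Real.log n := by
    have := Real.log_le_log (by norm_num) hn'
    linarith [Real.log_two_gt_d9]
  have e : 2 / deltaAt K l (1 / (n : ℝ)) t = 2 * Real.pi ^ 2 / 3 * (K * l) * t ^ 2 * n := by
    unfold deltaAt; field_simp
  have hpi1 : 1 ≤ 2 * Real.pi ^ 2 / 3 := by nlinarith [Real.pi_gt_three]
  have hpi2 : 2 * Real.pi ^ 2 / 3 ≤ 8 := by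
    nlinarith [Real.pi_lt_d2, Real.pi_gt_three]
  have hlow : Real.log n ≤ Real.log (2 / deltaAt K l (1 / (n : ℝ)) t) := by
    refine Real.log_le_log (by linarith) ?_
    rw [e]
    have h1 : 1 ≤ 2 * Real.pi ^ 2 / 3 * (K * l) := one_le_mul_of_one_le_of_one_le hpi1 hKl
    have h2 : 1 ≤ 2 * Real.pi ^ 2 / 3 * (K * l) * t ^ 2 :=
      one_le_mul_of_one_le_of_one_le h1 (one_le_pow₀ ht')
    nlinarith
  -- The argument is at most `8 K l n³`. Here `log (8 K l) ≤ 8 K l ≤ 16 K l log n` because `log n ≥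
  -- 1/2`.
  have hup : Real.log (2 / deltaAt K l (1 / (n : ℝ)) t) ≤ (16 * K * l + 3) * Real.log n := by
    have h1 : 2 / deltaAt K l (1 / (n : ℝ)) t ≤ 8 * (K * l) * (n : ℝ) ^ 3 := by
      rw [e]
      have h2 : (t : ℝ) ^ 2 ≤ (n : ℝ) ^ 2 := pow_le_pow_left₀ (by linarith) htn' 2
      calc 2 * Real.pi ^ 2 / 3 * (K * l) * t ^ 2 * n ≤ 8 * (K * l) * n ^ 2 * n := by gcongr
        _ = _ := by ring
    have h3 := Real.log_le_log (by rw [e]; positivity) h1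
    rw [Real.log_mul (by positivity) (by positivity), Real.log_pow] at h3
    have h4 := Real.log_le_self (show (0 : ℝ) ≤ 8 * (K * l) by positivity)
    push_cast at h3
    nlinarith
  have hl2 : (1 : ℝ) ≤ (l : ℝ) ^ 2 := one_le_pow₀ hl'
  rw [Real.sqrt_div' _ hx]
  constructor
  · refine div_le_div_of_nonneg_right (Real.sqrt_le_sqrt ?_) (Real.sqrt_nonneg _)
    nlinarith
  · refine div_le_div_of_nonneg_right ?_ (Real.sqrt_nonneg _)
    rw [← Real.sqrt_mul (by positivity), mul_assoc (2 * (l : ℝ) ^ 2)]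
    exact Real.sqrt_le_sqrt (mul_le_mul_of_nonneg_left hup (by positivity))

set_option maxHeartbeats 800000 in
/-- The comparison of the objectives of two arms at the last pull of an arm `k` that has at least
its share `w = λ_k n` of the pulls; `x` and `y` are the numbers of pulls of `i` and `k`. -/
lemma allocation_estimate {N r lam₀ ci ck C D A A' w x y ui uk E₀ Y : ℝ} (hN : 1 ≤ N)
    (hr : 1 / 2 ≤ r) (hl0 : 0 < lam₀) (hl1 : lam₀ ≤ 1) (hC0 : 0 < C) (hCD : C ≤ D) (hA : 0 ≤ A)
    (hA' : 0 ≤ A') (hci0 : 0 ≤ ci) (hci : lam₀ * C ^ 2 ≤ ci ^ 2)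
    (hckw : ck ^ 2 * N = w * C ^ 2) (hw2 : 2 ≤ w) (hw : lam₀ * N ≤ w) (hy : w - 1 ≤ y)
    (hx1 : 1 ≤ x) (hxN : x ≤ N)
    (hui1 : r / √x ≤ ui) (hui2 : ci - A * r / √x ≤ ui) (huk : uk ≤ ck + A' * r / √y)
    (hcmp : ui / √x ≤ uk / √y) (hE₀ : E₀ = 2 * D / lam₀ + 2 * A' / lam₀)
    (hY : Y = (2 + A) * (1 + E₀) / lam₀) :
    N ≤ Y ^ 2 * x ∧ ci / √x ≤ C / √N + (E₀ + A * Y ^ 2) * (r / N) := by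
  have hN0 : 0 < N := by linarith
  have hx0 : 0 < x := by linarith
  have hy0 : 0 < y := by linarith
  have hsN : 0 < √N := Real.sqrt_pos.2 hN0
  have hsx : 0 < √x := Real.sqrt_pos.2 hx0
  have hsy : 0 < √y := Real.sqrt_pos.2 hy0
  have hsN2 : √N * √N = N := Real.mul_self_sqrt hN0.le
  have hsx2 : √x * √x = x := Real.mul_self_sqrt hx0.le
  have hsy2 : √y * √y = y := Real.mul_self_sqrt hy0.le
  have hsN1 : 1 ≤ √N := Real.one_le_sqrt.2 hN
  have hr0 : 0 < r := by linarith
  have hw0 : 0 < w := by linarith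
  have hE₀0 : 0 ≤ E₀ := by rw [hE₀]; have : 0 ≤ D := by linarith
                           positivity
  set U := uk / √y with hU
  -- Before its last pull arm `k` may be one short of its share. The loss is a factor `1 + 1 / w`,
  -- by `w ≤ (1 + 1/w)² (w - 1)` for `w ≥ 2`.
  have hck : ck / √y ≤ C / √N + 2 * D / lam₀ * (r / N) := by
    have h1 : ck / √y ≤ C / √N * (1 + 1 / w) := by
      rw [div_mul_eq_mul_div, div_le_div_iff₀ hsy hsN]
      refine le_of_sq_le_sq ?_ (by positivity)
      have e1 : (ck * √N) ^ 2 = w * C ^ 2 := by rw [mul_pow, sq (√N), hsN2, hckw]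
      have e2 : (C * (1 + 1 / w) * √y) ^ 2 = C ^ 2 * ((1 + 1 / w) ^ 2 * y) := by
        rw [mul_pow, mul_pow, sq (√y), hsy2]; ring
      rw [e1, e2, mul_comm]
      refine mul_le_mul_of_nonneg_left ?_ (sq_nonneg _)
      have h2 : w ≤ (1 + 1 / w) ^ 2 * (w - 1) := by
        have e3 : (1 + 1 / w) ^ 2 * (w - 1) = (w + 1) ^ 2 * (w - 1) / w ^ 2 := by field_simp
        rw [e3, le_div_iff₀ (by positivity)]
        nlinarith
      exact h2.trans (mul_le_mul_of_nonneg_left hy (sq_nonneg _))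
    have h3 : C / √N * (1 / w) ≤ 2 * D / lam₀ * (r / N) := by
      have hD0 : 0 ≤ D := by linarith
      calc C / √N * (1 / w) ≤ D / 1 * (1 / (lam₀ * N)) := by gcongr
        _ = D * 1 / (lam₀ * N) := by ring
        _ ≤ D * (2 * r) / (lam₀ * N) := by
            refine div_le_div_of_nonneg_right ?_ (by positivity)
            exact mul_le_mul_of_nonneg_left (by linarith) (by linarith)
        _ = _ := by field_simp
    linarith [h1, h3, mul_add (C / √N) 1 (1 / w)]
  have hUle : U ≤ C / √N + E₀ * (r / N) := by
    have h1 : U ≤ ck / √y + A' * r / y := by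
      rw [hU]
      refine (div_le_div_of_nonneg_right huk hsy.le).trans (le_of_eq ?_)
      rw [add_div, div_div, hsy2]
    have h2 : A' * r / y ≤ 2 * A' / lam₀ * (r / N) := by
      have : lam₀ * N / 2 ≤ y := by linarith
      calc A' * r / y ≤ A' * r / (lam₀ * N / 2) := by gcongr
        _ = _ := by field_simp
    rw [hE₀]
    linarith [h1, h2, hck, add_mul (2 * D / lam₀) (2 * A' / lam₀) (r / N)]
  have hlow1 : r / x ≤ U := by
    refine le_trans ?_ hcmp
    refine le_trans (le_of_eq ?_) (div_le_div_of_nonneg_right hui1 hsx.le)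
    rw [div_div, hsx2]
  have hlow2 : ci / √x ≤ U + A * (r / x) := by
    have := (div_le_div_of_nonneg_right hui2 hsx.le).trans hcmp
    rw [sub_div, div_div, hsx2] at this
    rw [← mul_div_assoc]
    linarith
  -- A priori bound on `ρ = √(N / x)`. The parameter `ci` bounds the `C / √N` part of `lam₀ ρ V` and
  -- the bonus bounds the `r / N` part, so `lam₀ ρ V ≤ (2 + A) U`. Using the sum of both parts makes
  -- the bound independent of which one dominates, hence of `C`.
  set V := C / √N + r / N with hV
  have hCN : 0 < C / √N := by positivity
  have hrN : 0 < r / N := by positivity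
  have hUV : U ≤ (1 + E₀) * V := by
    have h1 : 0 ≤ E₀ * (C / √N) := by positivity
    have h2 : (1 + E₀) * V = C / √N + r / N + E₀ * (C / √N) + E₀ * (r / N) := by rw [hV]; ring
    linarith
  set ρ := √N / √x with hρ
  have hρ1 : 1 ≤ ρ := by
    rw [hρ, one_le_div hsx]; exact Real.sqrt_le_sqrt hxN
  have hρ2 : ρ ^ 2 * x = N := by
    rw [hρ, div_pow, sq (√N), sq (√x), hsN2, hsx2]; field_simp
  have hciC : lam₀ * C ≤ ci := by
    refine le_of_sq_le_sq ?_ hci0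
    have h1 := mul_le_mul_of_nonneg_right hl1 (mul_nonneg hl0.le (sq_nonneg C))
    have h2 : (lam₀ * C) ^ 2 = lam₀ * (lam₀ * C ^ 2) := by ring
    linarith
  have h1 : lam₀ * (C / √N) * ρ ≤ U + A * (r / x) := by
    refine le_trans ?_ hlow2
    have : lam₀ * (C / √N) * ρ = lam₀ * C / √x := by rw [hρ]; field_simp
    rw [this]
    exact div_le_div_of_nonneg_right hciC hsx.le
  have h2 : lam₀ * (r / N) * ρ ≤ r / x := by
    have : r / x = r / N * ρ ^ 2 := by rw [← hρ2]; field_simp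
    rw [this]
    have h3 := mul_le_mul_of_nonneg_left hρ1 (by positivity : 0 ≤ r / N * ρ)
    have h4 := mul_le_mul_of_nonneg_right hl1 (by positivity : 0 ≤ r / N * ρ)
    linarith [h3, h4, sq ρ, mul_assoc (r / N) ρ ρ, mul_assoc lam₀ (r / N) ρ]
  have hU0 : 0 < U := lt_of_lt_of_le (by positivity) hlow1
  have h3 : lam₀ * ρ * V ≤ (2 + A) * (1 + E₀) * V := by
    have h4 : lam₀ * ρ * V ≤ (2 + A) * U := by
      have h5 : lam₀ * ρ * V = lam₀ * (C / √N) * ρ + lam₀ * (r / N) * ρ := by rw [hV]; ring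
      have h6 := mul_le_mul_of_nonneg_left hlow1 hA
      linarith
    calc lam₀ * ρ * V ≤ (2 + A) * U := h4
      _ ≤ (2 + A) * ((1 + E₀) * V) := mul_le_mul_of_nonneg_left hUV (by linarith)
      _ = _ := by ring
  have hρY : ρ ≤ Y := by
    rw [hY, le_div_iff₀ hl0, mul_comm]
    exact le_of_mul_le_mul_right h3 (by positivity)
  have hNY : N ≤ Y ^ 2 * x := by
    rw [← hρ2]
    exact mul_le_mul_of_nonneg_right (pow_le_pow_left₀ (by linarith) hρY 2) hx0.le
  refine ⟨hNY, ?_⟩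
  -- The a priori bound now turns the estimation error at `x` pulls into one of order `r / N`.
  have h5 : A * (r / x) ≤ A * Y ^ 2 * (r / N) := by
    rw [mul_assoc]
    refine mul_le_mul_of_nonneg_left ?_ hA
    rw [← mul_div_assoc, div_le_div_iff₀ hx0 hN0]
    have := mul_le_mul_of_nonneg_left hNY hr0.le
    linarith
  linarith [h5, hlow2, hUle, add_mul E₀ (A * Y ^ 2) (r / N)]

/-! ### The weights `λ i` -/

section

variable {K l : ℕ} {p : Fin K → Fin l → ℝ} {lam₀ : ℝ}

lemma lamMin_le (p : Fin K → Fin l → ℝ) (i : Fin K) : lamMin p ≤ lam p i :=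
  ciInf_le (Set.finite_range _).bddBelow i

lemma cNorm_sq (p : Fin K → Fin l → ℝ) : cNorm p ^ 2 = ∑ i, cParam (p i) ^ 2 :=
  Real.sq_sqrt (Finset.sum_nonneg fun _ _ => sq_nonneg _)

/-- If `C` were 0, division by zero would make every `λ_i` equal to 0. -/
lemma cNorm_pos (hK : 0 < K) (h0 : 0 < lam₀) (h : lam₀ ≤ lamMin p) : 0 < cNorm p := by
  refine lt_of_le_of_ne (Real.sqrt_nonneg _) fun hz => ?_
  have h1 := h.trans (lamMin_le p ⟨0, hK⟩)
  rw [lam, ← hz] at h1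
  norm_num at h1
  linarith

lemma cParam_sq (hC : 0 < cNorm p) (i : Fin K) : cParam (p i) ^ 2 = lam p i * cNorm p ^ 2 := by
  rw [lam]; field_simp

lemma sum_lam (hC : 0 < cNorm p) : ∑ i, lam p i = 1 := by
  simp only [lam]
  rw [← Finset.sum_div, ← cNorm_sq]
  field_simp

lemma lam_nonneg (i : Fin K) : 0 ≤ lam p i := by unfold lam; positivity

lemma lam_le_one (hC : 0 < cNorm p) (i : Fin K) : lam p i ≤ 1 := by
  rw [← sum_lam hC]
  exact Finset.single_le_sum (f := lam p) (fun i _ => lam_nonneg i) (Finset.mem_univ i)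

lemma cParam_eq (hC : 0 < cNorm p) (i : Fin K) : cParam (p i) = cNorm p * √(lam p i) := by
  rw [lam, Real.sqrt_div (sq_nonneg _), Real.sqrt_sq (cParam_nonneg _), Real.sqrt_sq hC.le]
  field_simp

lemma cParam_le_cNorm (i : Fin K) : cParam (p i) ≤ cNorm p :=
  Real.le_sqrt_of_sq_le
    (Finset.single_le_sum (f := fun i => cParam (p i) ^ 2) (fun _ _ => sq_nonneg _)
      (Finset.mem_univ i))

lemma cNorm_le (hK : 0 < K) (p : Fin K → Fin l → ℝ) : cNorm p ≤ K * l := by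
  have hK' : (1 : ℝ) ≤ K := by exact_mod_cast hK
  rw [cNorm, Real.sqrt_le_left (by positivity)]
  have : ∀ i ∈ Finset.univ, cParam (p i) ^ 2 ≤ (l : ℝ) ^ 2 := fun i _ =>
    pow_le_pow_left₀ (cParam_nonneg _) (cParam_le _) 2
  refine (Finset.sum_le_sum this).trans ?_
  simp only [Finset.sum_const, Finset.card_univ, Fintype.card_fin, nsmul_eq_mul]
  rw [mul_pow]
  exact mul_le_mul_of_nonneg_right (by nlinarith) (sq_nonneg _)

end

/-! ### The allocation on the good event -/

/-- The deviation of the optimistic estimates from `c_i`, in units of `√(log n / T_i)`. -/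
def ucbDev (K l : ℕ) : ℝ := 5 * l + √(2 * (l : ℝ) ^ 2 * (16 * K * l + 3))

/-- Auxiliary constant of the allocation bounds. -/
def allocDev (K l : ℕ) (lam₀ : ℝ) : ℝ := 2 * (K * l) / lam₀ + 2 * ucbDev K l / lam₀

/-- The square of this constant bounds `n / T_i`. -/
def shareBound (K l : ℕ) (lam₀ : ℝ) : ℝ := (2 + 5 * l) * (1 + allocDev K l lam₀) / lam₀

/-- The excess of `c_i / √T_i` over `C / √n`, in units of `√(log n) / n`. -/
def excess (K l : ℕ) (lam₀ : ℝ) : ℝ := allocDev K l lam₀ + 5 * l * shareBound K l lam₀ ^ 2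

lemma half_le_sqrt_log {n : ℕ} (hn : 2 ≤ n) : 1 / 2 ≤ √(Real.log n) := by
  apply Real.le_sqrt_of_sq_le
  have := Real.log_le_log (by norm_num) (show (2 : ℝ) ≤ n by exact_mod_cast hn)
  linarith [Real.log_two_gt_d9]

/-- As `∑ λ_i = 1`, some arm `k` receives at least `λ_k n ≥ 2` pulls, so its last pull comes after
the initial rounds. At that moment its index dominates that of every arm `i`, which forces `c_i /
√T_i` to be small. Later pulls only decrease it. -/
lemma IsOptimisticTracking.allocation_bounds {K l n : ℕ} {Ω : Type*} {π : Scheme K l}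
    {p : Fin K → Fin l → ℝ} {X : Fin K → ℕ → Ω → Fin l} {lam₀ : ℝ} {ω : Ω}
    (hπ : IsOptimisticTracking π n (1 / (n : ℝ))) (hK : 0 < K) (hl : 0 < l) (hKn : K ≤ n)
    (hn : 2 ≤ n) (hlam₀ : 0 < lam₀) (hlam : lam₀ ≤ lamMin p) (hn2 : 2 ≤ lam₀ * n)
    (hp0 : ∀ i j, 0 ≤ p i j) (hp1 : ∀ i j, p i j ≤ 1) (hω : ω ∈ goodEvent p X n) (i : Fin K) :
    (n : ℝ) ≤ shareBound K l lam₀ ^ 2 * pulls (run π n X ω n) i ∧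
      cParam (p i) / √(pulls (run π n X ω n) i : ℝ)
        ≤ cNorm p / √n + excess K l lam₀ * (√(Real.log n) / n) := by
  have hC := cNorm_pos hK hlam₀ hlam
  have hn0 : (0 : ℝ) < n := by positivity
  have hlami : ∀ i, lam₀ ≤ lam p i := fun i => hlam.trans (lamMin_le p i)
  -- an arm with at least its share of the pulls
  obtain ⟨k, -, hk⟩ : ∃ k ∈ (Finset.univ : Finset (Fin K)),
      lam p k * n ≤ pulls (run π n X ω n) k := by
    refine Finset.exists_le_of_sum_le ⟨⟨0, hK⟩, Finset.mem_univ _⟩ ?_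
    rw [← Finset.sum_mul, sum_lam hC, one_mul]
    exact_mod_cast (sum_pulls_run π n X ω n).ge
  have hw : lam₀ * n ≤ lam p k * n := mul_le_mul_of_nonneg_right (hlami k) hn0.le
  have hk2 : 2 ≤ pulls (run π n X ω n) k := by
    have : (2 : ℝ) ≤ pulls (run π n X ω n) k := by linarith
    exact_mod_cast this
  obtain ⟨t, hKt, htn, hπt, hpt⟩ := hπ.exists_last_pull hKn X ω hKn k hk2
  have hpt' : (pulls (run π n X ω t) k : ℝ) = pulls (run π n X ω n) k - 1 := by
    rw [← hpt]; push_cast; ring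
  have hcmp := (hπ (run π n X ω t) (by simpa using htn)).2 (by simpa using hKt) i
  rw [hπt] at hcmp
  have hT1 : ∀ i, 1 ≤ pulls (run π n X ω t) i := fun i => hπ.one_le_pulls_run hKn X ω hKt i
  have hTn : ∀ i, pulls (run π n X ω t) i ≤ n := fun i =>
    (pulls_run_le π n X ω t i).trans htn.le
  have hconc : ∀ i, |cParam (empirical (run π n X ω t) i) - cParam (p i)|
      ≤ 5 * l * √(Real.log n) / √(pulls (run π n X ω t) i : ℝ) := by
    intro i
    rw [empirical_run]
    exact abs_cParam_empDraws_sub_le hp0 hp1 hω i (hT1 i) (hTn i)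
  have hbonus : ∀ i, _ := fun i => bonus_bounds hK hl hn (t := t + 1) (by omega) (by omega)
    (Nat.cast_nonneg (pulls (run π n X ω t) i) : (0 : ℝ) ≤ _)
  have hmono : (pulls (run π n X ω t) i : ℝ) ≤ pulls (run π n X ω n) i := by
    exact_mod_cast pulls_run_mono π n X ω i htn.le
  have hxpos : (0 : ℝ) < pulls (run π n X ω t) i := by exact_mod_cast hT1 i
  have hci := cParam_sq hC i
  have hbi := hbonus i
  have hbk := hbonus k
  have hcoi := abs_le.1 (hconc i)
  have hcok := abs_le.1 (hconc k)
  have hbi0 : 0 ≤ √(Real.log n) / √(pulls (run π n X ω t) i : ℝ) := by positivity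
  have hest := allocation_estimate (N := n) (r := √(Real.log n)) (lam₀ := lam₀)
    (ci := cParam (p i)) (ck := cParam (p k)) (C := cNorm p) (D := K * l) (A := 5 * l)
    (A' := ucbDev K l) (w := lam p k * n) (x := pulls (run π n X ω t) i)
    (y := pulls (run π n X ω t) k) (ui := ucb (1 / (n : ℝ)) (run π n X ω t) i)
    (uk := ucb (1 / (n : ℝ)) (run π n X ω t) k)
    (E₀ := allocDev K l lam₀) (Y := shareBound K l lam₀)
    (by linarith [show (2 : ℝ) ≤ n by exact_mod_cast hn]) (half_le_sqrt_log hn) hlam₀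
    ((hlami k).trans (lam_le_one hC k)) hC (cNorm_le hK p) (by positivity)
    (by unfold ucbDev; positivity) (cParam_nonneg _)
    (by rw [hci]; exact mul_le_mul_of_nonneg_right (hlami i) (sq_nonneg _))
    (by rw [cParam_sq hC k]; ring) (by linarith) hw (by rw [hpt']; linarith)
    (by exact_mod_cast hT1 i) (by exact_mod_cast hTn i)
    (by
      simp only [ucb, length_run]
      linarith [hbi.1, cParam_nonneg (empirical (run π n X ω t) i)])
    (by
      simp only [ucb, length_run]
      linarith [hbi.1, hcoi.1])
    (by
      simp only [ucb, length_run, ucbDev]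
      rw [add_mul, add_div]
      linarith [hbk.2, hcok.2])
    hcmp rfl rfl
  refine ⟨hest.1.trans (mul_le_mul_of_nonneg_left hmono (sq_nonneg _)), le_trans ?_ hest.2⟩
  exact div_le_div_of_nonneg_left (cParam_nonneg _) (Real.sqrt_pos.2 hxpos)
    (Real.sqrt_le_sqrt hmono)

/-- Two-sided bounds of the numbers of pulls from bounds of `c_i / √T_i`. -/
lemma pulls_between {K : ℕ} {c lm T : Fin K → ℝ} {C N η : ℝ} (hC : 0 < C) (hN : 0 < N)
    (hη : 0 ≤ η) (hc : ∀ i, c i = C * √(lm i)) (hlm : ∀ i, 0 ≤ lm i) (hlsum : ∑ i, lm i = 1)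
    (hT : ∀ i, 0 < T i) (hTsum : ∑ i, T i = N) (h : ∀ i, c i / √(T i) ≤ C / √N * (1 + η))
    (i : Fin K) : lm i * N / (1 + η) ^ 2 ≤ T i ∧ T i ≤ lm i * N + 2 * η * N := by
  have hlow : ∀ i, lm i * N / (1 + η) ^ 2 ≤ T i := by
    intro i
    have hsN : 0 < √N := Real.sqrt_pos.2 hN
    have hsT : 0 < √(T i) := Real.sqrt_pos.2 (hT i)
    have h1 := h i
    rw [hc, div_mul_eq_mul_div, div_le_div_iff₀ hsT hsN, mul_assoc, mul_assoc,
      mul_le_mul_iff_right₀ hC] at h1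
    have h2 := pow_le_pow_left₀ (by positivity) h1 2
    rw [mul_pow, mul_pow, Real.sq_sqrt (hlm i), Real.sq_sqrt hN.le, Real.sq_sqrt (hT i).le] at h2
    rw [div_le_iff₀ (by positivity)]
    linarith
  refine ⟨hlow i, ?_⟩
  -- The upper bound on `T i` comes from the lower bounds on the other arms and the total `N`, after
  -- linearising `1 / (1 + η)² ≥ 1 - 2 η`.
  have hlow' : ∀ j, lm j * N * (1 - 2 * η) ≤ T j := by
    intro j
    refine le_trans ?_ (hlow j)
    rw [le_div_iff₀ (by positivity), mul_assoc]
    refine mul_le_of_le_one_right (mul_nonneg (hlm j) hN.le) ?_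
    nlinarith [pow_nonneg hη 3, sq_nonneg η]
  have h1 := Finset.sum_erase_add Finset.univ T (Finset.mem_univ i)
  have h2 := Finset.sum_erase_add Finset.univ lm (Finset.mem_univ i)
  have h3 := Finset.sum_le_sum fun j (_ : j ∈ Finset.univ.erase i) => hlow' j
  rw [← Finset.sum_mul, ← Finset.sum_mul] at h3
  have h4 : ∑ j ∈ Finset.univ.erase i, lm j = 1 - lm i := by linarith
  rw [h4] at h3
  have h5 : 0 ≤ lm i * (η * N) := mul_nonneg (hlm i) (by positivity)
  nlinarith

/-! ### The risk of an arm and the oracle risk -/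

section

variable {K l : ℕ} {Ω : Type*} {p : Fin K → Fin l → ℝ} {X : Fin K → ℕ → Ω → Fin l}

lemma distL1_empDraws_le (hp0 : ∀ i j, 0 ≤ p i j) (hp1 : ∀ i j, p i j ≤ 1) (i : Fin K) (T : ℕ)
    (ω : Ω) : distL1 (empDraws X ω i T) (p i) ≤ l := by
  have : ∀ j ∈ Finset.univ, |empDraws X ω i T j - p i j| ≤ 1 := fun j _ => by
    have h1 := empDraws_nonneg (X := X) i T j ω
    have h2 := empDraws_le_one (X := X) i T j ω
    rw [abs_le]; constructor <;> linarith [hp0 i j, hp1 i j]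
  exact (Finset.sum_le_sum this).trans (le_of_eq (by simp))

lemma distL1_nonneg {l : ℕ} (p q : Fin l → ℝ) : 0 ≤ distL1 p q :=
  Finset.sum_nonneg fun _ _ => abs_nonneg _

variable [MeasurableSpace Ω] {μ : Measure Ω} [IsProbabilityMeasure μ]

/-- Off the good event the distance is at most `l`. On it, the random denominator is replaced by
`m'` and the random number of summands by `m`, the latter through optional stopping; Stein's
estimate evaluates the result. -/
lemma IsSampling.integral_distL1_run_le (hX : IsSampling μ p X) (hp0 : ∀ i j, 0 ≤ p i j)
    (hp1 : ∀ i j, p i j ≤ 1) {L : ℝ}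
    (hL : ∀ x y, |steinDeriv y - steinDeriv x| ≤ L * |y - x|) (hL0 : 0 ≤ L) (π : Scheme K l)
    {n : ℕ} (hn : 2 ≤ n) (i : Fin K) (m : ℕ) {m' : ℝ} (hm' : 0 < m')
    (h : ∀ ω ∈ goodEvent p X n, m' ≤ pulls (run π n X ω n) i ∧ pulls (run π n X ω n) i ≤ m) :
    ∫ ω, distL1 (empirical (run π n X ω n) i) (p i) ∂μ
      ≤ 2 * K * l ^ 2 / n + (gaussMean * cParam (p i) * √m + l * (2 * L)) / m' := by
  -- Truncated because `T_i ≤ m` is guaranteed only on the good event, while optional stopping needs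
  -- a quantity defined everywhere.
  let Z : Fin l → Ω → ℝ := fun j ω => if pulls (run π n X ω n) i ≤ m then
    |∑ r ∈ Finset.range (pulls (run π n X ω n) i), centred p X i j r ω| else 0
  have hZm : ∀ j, Measurable (Z j) := by
    intro j
    have : Z j = fun ω => (fun h : History K l => if pulls h i ≤ m then
        |(h.count (i, j) : ℝ) - pulls h i * p i j| else 0) (run π n X ω n) := by
      ext ω
      simp only [Z, ← card_filter_sub, count_run]
    rw [this]
    exact measurable_run_comp hX.measurable π n fun h => if pulls h i ≤ m then
      |(h.count (i, j) : ℝ) - pulls h i * p i j| else 0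
  have hZ0 : ∀ j ω, 0 ≤ Z j ω := fun j ω => by
    simp only [Z]; split_ifs
    · exact abs_nonneg _
    · exact le_rfl
  have hZi : ∀ j, Integrable (Z j) μ := fun j =>
    integrable_of_abs_le (R := m) (hZm j) fun ω => by
      rw [abs_of_nonneg (hZ0 j ω)]
      simp only [Z]; split_ifs with hh
      · exact (abs_sum_range_le (hX.isCentredSeq i j).bound _ ω).trans (by exact_mod_cast hh)
      · positivity
  have hGm := (hX.measurableSet_goodEvent n).compl
  have hBi : Integrable ((goodEvent p X n)ᶜ.indicator fun _ => (l : ℝ)) μ :=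
    (integrable_const _).indicator hGm
  have hSi : Integrable (fun ω => (∑ j, Z j ω) / m') μ :=
    (integrable_finsetSum _ fun j _ => hZi j).div_const _
  have hpt : ∀ ω, distL1 (empirical (run π n X ω n) i) (p i)
      ≤ (goodEvent p X n)ᶜ.indicator (fun _ => (l : ℝ)) ω + (∑ j, Z j ω) / m' := by
    intro ω
    have hS0 : 0 ≤ (∑ j, Z j ω) / m' :=
      div_nonneg (Finset.sum_nonneg fun j _ => hZ0 j ω) hm'.le
    rw [empirical_run]
    by_cases hω : ω ∈ goodEvent p X n
    · obtain ⟨h1, h2⟩ := h ω hω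
      have hT : 1 ≤ pulls (run π n X ω n) i := by
        have : (0 : ℝ) < pulls (run π n X ω n) i := hm'.trans_le h1
        exact_mod_cast this
      rw [Set.indicator_of_notMem (by simpa using hω), zero_add, distL1_empDraws i hT]
      simp only [Z, h2, if_true]
      exact div_le_div_of_nonneg_left (Finset.sum_nonneg fun _ _ => abs_nonneg _) hm' h1
    · rw [Set.indicator_of_mem (by simpa using hω)]
      have := distL1_empDraws_le (X := X) hp0 hp1 i (pulls (run π n X ω n) i) ω
      linarith
  have h1 : ∫ ω, distL1 (empirical (run π n X ω n) i) (p i) ∂μ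
      ≤ ∫ ω, ((goodEvent p X n)ᶜ.indicator (fun _ => (l : ℝ)) ω + (∑ j, Z j ω) / m') ∂μ :=
    integral_mono_of_nonneg (Filter.Eventually.of_forall fun ω => distL1_nonneg _ _)
      (hBi.add hSi) (Filter.Eventually.of_forall hpt)
  refine h1.trans ?_
  rw [integral_add hBi hSi, integral_indicator_const _ hGm, integral_div,
    integral_finsetSum _ fun j _ => hZi j, smul_eq_mul]
  refine add_le_add ?_ (div_le_div_of_nonneg_right ?_ hm'.le)
  · refine (mul_le_mul_of_nonneg_right (hX.measureReal_compl_goodEvent_le hn)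
      (Nat.cast_nonneg l)).trans (le_of_eq (by ring))
  · have h2 := Finset.sum_le_sum fun j (_ : j ∈ Finset.univ) =>
      hX.integral_abs_stopped_le π n i j m
    have h3 := (abs_le.1 (hX.abs_integral_dev_sub_le hL hL0 i m)).2
    have h4 : ∑ j, ∫ ω, Z j ω ∂μ
      ≤ ∑ j, ∫ ω, |∑ r ∈ Finset.range m, centred p X i j r ω| ∂μ := h2
    linarith

lemma IsSampling.gam_eq (hX : IsSampling μ p X) (i : Fin K) {T : ℕ} (hT : 1 ≤ T) :
    gam μ p X i T = (∑ j, ∫ ω, |∑ s ∈ Finset.range T, centred p X i j s ω| ∂μ) / T := by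
  have h : ∀ ω, distL1 (fun j => (((Finset.range T).filter (fun s => X i s ω = j)).card : ℝ)
      / (T : ℝ)) (p i) = (∑ j, |∑ s ∈ Finset.range T, centred p X i j s ω|) / T :=
    fun ω => distL1_empDraws i hT ω
  simp only [gam, h]
  rw [integral_div, integral_finsetSum]
  intro j _
  have hc := hX.isCentredSeq i j
  exact integrable_of_abs_le (R := T) (hc.measurable_sum _).abs fun ω => by
    rw [abs_abs]; exact abs_sum_range_le hc.bound T ω

lemma IsSampling.le_gam (hX : IsSampling μ p X) {L : ℝ}
    (hL : ∀ x y, |steinDeriv y - steinDeriv x| ≤ L * |y - x|) (hL0 : 0 ≤ L) (i : Fin K) {T : ℕ}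
    (hT : 1 ≤ T) : gaussMean * (cParam (p i) / √T) - l * (2 * L) / T ≤ gam μ p X i T := by
  have hT0 : (0 : ℝ) < T := by positivity
  have hsT : 0 < √(T : ℝ) := Real.sqrt_pos.2 hT0
  rw [hX.gam_eq i hT, le_div_iff₀ hT0]
  have h := (abs_le.1 (hX.abs_integral_dev_sub_le hL hL0 i T)).1
  have e : (gaussMean * (cParam (p i) / √T) - l * (2 * L) / T) * T
      = gaussMean * cParam (p i) * √T - l * (2 * L) := by
    have : (T : ℝ) = √T * √T := (Real.mul_self_sqrt hT0.le).symm
    rw [sub_mul, div_mul_cancel₀ _ hT0.ne']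
    nth_rewrite 2 [this]
    field_simp
  rw [e]
  linarith

/-- The oracle risk is at least `√(2 / π) C / √n`, up to `O(1 / n)`. -/
lemma IsSampling.le_oracleRisk (hX : IsSampling μ p X) {L : ℝ}
    (hL : ∀ x y, |steinDeriv y - steinDeriv x| ≤ L * |y - x|) (hL0 : 0 ≤ L) (hK : 0 < K)
    {lam₀ : ℝ} (hlam₀ : 0 < lam₀) (hlam : lam₀ ≤ lamMin p) {n : ℕ} (hn : 1 ≤ n)
    {g : Fin K → ℝ → ℝ} (hg : IsObjectiveExtension (gam μ p X) g) :
    gaussMean * (cNorm p / √n) - (gaussMean * (K * l) + l * (2 * L)) / lam₀ / n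
      ≤ oracleRisk g n := by
  have hC := cNorm_pos hK hlam₀ hlam
  have hn0 : (0 : ℝ) < n := by positivity
  have hK0 : (0 : ℝ) < K := by positivity
  have ha := gaussMean_pos
  have : Nonempty {T : Fin K → ℝ // (∀ i, 0 < T i) ∧ ∑ i, T i = (n : ℝ)} :=
    ⟨⟨fun _ => n / K, fun _ => by positivity, by simp; field_simp⟩⟩
  refine le_ciInf fun T => ?_
  obtain ⟨T, hTpos, hTsum⟩ := T
  obtain ⟨i, -, hi⟩ : ∃ i ∈ (Finset.univ : Finset (Fin K)), T i ≤ lam p i * n := by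
    refine Finset.exists_le_of_sum_le ⟨⟨0, hK⟩, Finset.mem_univ _⟩ ?_
    rw [← Finset.sum_mul, sum_lam hC, one_mul, hTsum]
  refine le_trans ?_ (le_ciSup (Set.finite_range fun i => g i (T i)).bddAbove i)
  have hlami : lam₀ ≤ lam p i := hlam.trans (lamMin_le p i)
  set w := lam p i * n with hw
  have hw0 : 0 < w := mul_pos (hlam₀.trans_le hlami) hn0
  have hwl : lam₀ * n ≤ w := mul_le_mul_of_nonneg_right hlami hn0.le
  -- Only the values of `g` at integers are known, so monotonicity is used to pass from `T i ≤ w` to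
  -- the next integer above `w`. The rounding costs a factor `1 - 1 / w`.
  set N := ⌈w⌉₊ with hN
  have hN1 : 1 ≤ N := Nat.one_le_iff_ne_zero.2 (Nat.ceil_pos.2 hw0).ne'
  have hwN : w ≤ N := Nat.le_ceil w
  have hNw : (N : ℝ) ≤ w + 1 := (Nat.ceil_lt_add_one hw0.le).le
  have hN0 : (0 : ℝ) < N := by positivity
  have h1 : g i N ≤ g i (T i) := (hg i).1 (hTpos i) (Set.mem_Ioi.2 hN0) (hi.trans hwN)
  rw [(hg i).2 N hN1] at h1
  refine le_trans ?_ h1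
  refine le_trans ?_ (hX.le_gam hL hL0 i hN1)
  have hsw : 0 < √w := Real.sqrt_pos.2 hw0
  have hsn : 0 < √(n : ℝ) := Real.sqrt_pos.2 hn0
  have hcw : cParam (p i) = cNorm p / √n * √w := by
    rw [cParam_eq hC, hw, Real.sqrt_mul (lam_nonneg i)]; field_simp
  have hCn : 0 < cNorm p / √n := by positivity
  have h2 : cNorm p / √n * (1 - 1 / w) ≤ cParam (p i) / √N := by
    rw [hcw, mul_div_assoc]
    refine mul_le_mul_of_nonneg_left ?_ hCn.le
    rcases le_total w 1 with h3 | h3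
    · have : 1 ≤ 1 / w := by rw [le_div_iff₀ hw0]; linarith
      have : 0 ≤ √w / √N := by positivity
      linarith
    · rw [← Real.sqrt_div hw0.le]
      apply Real.le_sqrt_of_sq_le
      have h4 : (1 - 1 / w) ^ 2 = (w - 1) ^ 2 / w ^ 2 := by field_simp
      rw [h4, div_le_div_iff₀ (by positivity) hN0]
      calc (w - 1) ^ 2 * N ≤ (w - 1) ^ 2 * (w + 1) := by gcongr
        _ ≤ w * w ^ 2 := by nlinarith
  have h3 : cNorm p / √n * (1 / w) ≤ K * l / (lam₀ * n) := by
    have h4 : cNorm p / √n ≤ K * l := by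
      refine (div_le_self hC.le (Real.one_le_sqrt.2 (by exact_mod_cast hn))).trans (cNorm_le hK p)
    calc cNorm p / √n * (1 / w) ≤ K * l * (1 / (lam₀ * n)) := by gcongr
      _ = _ := by ring
  have h4 : l * (2 * L) / N ≤ l * (2 * L) / (lam₀ * n) := by
    refine div_le_div_of_nonneg_left (by positivity) (by positivity) (hwl.trans hwN)
  have h5 : cNorm p / √n - K * l / (lam₀ * n) ≤ cParam (p i) / √N := by
    linarith [mul_sub (cNorm p / √n) 1 (1 / w)]
  have h6 := mul_le_mul_of_nonneg_left h5 ha.le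
  have h7 : (gaussMean * (K * l) + l * (2 * L)) / lam₀ / n
      = gaussMean * (K * l / (lam₀ * n)) + l * (2 * L) / (lam₀ * n) := by field_simp
  rw [h7]
  linarith

end

/-! ### The regret -/

/-- With a single arm there is no regret. -/
lemma regret_nonpos_of_one {l : ℕ} {Ω : Type*} [MeasurableSpace Ω] {μ : Measure Ω}
    {p : Fin 1 → Fin l → ℝ} {X : Fin 1 → ℕ → Ω → Fin l} {π : Scheme 1 l}
    {n : ℕ} (hn : 1 ≤ n) {g : Fin 1 → ℝ → ℝ} (hg : IsObjectiveExtension (gam μ p X) g) :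
    regret μ p X g π n ≤ 0 := by
  have hn0 : (0 : ℝ) < n := by positivity
  have hrisk : risk μ p X π n = gam μ p X 0 n := by
    have : ∀ i : Fin 1, ∫ ω, distL1 (empirical (run π n X ω n) i) (p i) ∂μ = gam μ p X 0 n := by
      intro i
      have hi := Subsingleton.elim i 0
      subst hi
      have : ∀ ω, pulls (run π n X ω n) 0 = n := fun ω => by
        simpa using sum_pulls_run π n X ω n
      simp only [empirical_run, this]
      rfl
    simp only [risk, this, ciSup_const]
  have : Nonempty {T : Fin 1 → ℝ // (∀ i, 0 < T i) ∧ ∑ i, T i = (n : ℝ)} :=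
    ⟨⟨fun _ => n, fun _ => hn0, by simp⟩⟩
  have horacle : gam μ p X 0 n ≤ oracleRisk g n := by
    refine le_ciInf fun T => ?_
    have hT : T.1 0 = n := by simpa using T.2.2
    rw [← (hg 0).2 n hn]
    refine (congrArg (g 0) hT).ge.trans ?_
    exact le_ciSup (Set.finite_range fun i => g i (T.1 i)).bddAbove 0
  rw [regret, hrisk]
  linarith

/-- The bound of the risk of an arm in the regime of small relative deviation `η`. -/
lemma arm_estimate {a B C N E r η lm lam₀ m : ℝ} (ha : 0 < a) (hB : 0 ≤ B) (hC : 0 < C)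
    (hN : 0 < N) (hη0 : 0 ≤ η) (hη1 : η ≤ 1) (hη : C / √N * η = E * (r / N)) (hl0 : 0 < lam₀)
    (hlm : lam₀ ≤ lm) (hlm1 : lm ≤ 1) (hm : m ≤ lm * N + 2 * η * N) :
    (a * (C * √lm) * √m + B) / (lm * N / (1 + η) ^ 2)
      ≤ a * (C / √N) + (7 * a * E / lam₀ * r + 4 * B / lam₀) / N := by
  have hlm0 : 0 < lm := hl0.trans_le hlm
  have hsN : 0 < √N := Real.sqrt_pos.2 hN
  have hsN2 : √N * √N = N := Real.mul_self_sqrt hN.le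
  have hsl : √lm * √lm = lm := Real.mul_self_sqrt hlm0.le
  have hsm : √m ≤ √lm * √N * (1 + η / lam₀) := by
    rw [Real.sqrt_le_left (by positivity)]
    have e : (√lm * √N * (1 + η / lam₀)) ^ 2
        = lm * N + 2 * (lm / lam₀) * η * N + lm * N * (η / lam₀) ^ 2 := by
      rw [mul_pow, mul_pow, sq (√lm), sq (√N), hsN2, hsl]; ring
    have h1 : 1 ≤ lm / lam₀ := by rw [one_le_div hl0]; exact hlm
    have h2 : 0 ≤ lm * N * (η / lam₀) ^ 2 := by positivity
    have h3 := mul_le_mul_of_nonneg_right h1 (by positivity : 0 ≤ 2 * η * N)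
    rw [e]
    linarith
  have hl1 : lam₀ ≤ 1 := hlm.trans hlm1
  -- 7 is `3 + 1 + 3`, from `(1 + η)² ≤ 1 + 3 η` and `η ≤ η / lam₀`.
  have hfac : (1 + η / lam₀) * (1 + η) ^ 2 ≤ 1 + 7 * (η / lam₀) := by
    have h1 : η ≤ η / lam₀ := by rw [le_div_iff₀ hl0]; nlinarith
    have h2 : (1 + η) ^ 2 ≤ 1 + 3 * η := by nlinarith
    have h3 : 0 ≤ η / lam₀ := by positivity
    calc (1 + η / lam₀) * (1 + η) ^ 2 ≤ (1 + η / lam₀) * (1 + 3 * η) := by gcongr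
      _ = 1 + 3 * η + η / lam₀ + 3 * (η / lam₀ * η) := by ring
      _ ≤ 1 + 7 * (η / lam₀) := by nlinarith [mul_le_mul_of_nonneg_left hη1 h3]
  have h1 : a * (C * √lm) * √m / (lm * N / (1 + η) ^ 2)
      ≤ a * (C / √N) * (1 + 7 * (η / lam₀)) := by
    calc a * (C * √lm) * √m / (lm * N / (1 + η) ^ 2)
        ≤ a * (C * √lm) * (√lm * √N * (1 + η / lam₀)) / (lm * N / (1 + η) ^ 2) := by gcongr
      _ = a * C * (√lm * √lm) * √N * ((1 + η / lam₀) * (1 + η) ^ 2) / (lm * N) := by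
          field_simp
      _ = a * (C / √N) * ((1 + η / lam₀) * (1 + η) ^ 2) := by
          rw [hsl]
          nth_rewrite 2 [← hsN2]
          field_simp
      _ ≤ _ := by gcongr
  have h2 : B / (lm * N / (1 + η) ^ 2) ≤ 4 * B / lam₀ / N := by
    have h3 : (1 + η) ^ 2 ≤ 4 := by nlinarith
    calc B / (lm * N / (1 + η) ^ 2) = B * (1 + η) ^ 2 / (lm * N) := by field_simp
      _ ≤ B * 4 / (lam₀ * N) := by gcongr
      _ = _ := by field_simp
  have h3 : a * (C / √N) * (1 + 7 * (η / lam₀)) = a * (C / √N) + 7 * a * E / lam₀ * r / N := by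
    have : a * (C / √N) * (1 + 7 * (η / lam₀))
        = a * (C / √N) + 7 * a / lam₀ * (C / √N * η) := by ring
    rw [this, hη]
    ring
  rw [add_div, add_div]
  linarith

section

variable {K l : ℕ} {Ω : Type*} [MeasurableSpace Ω] {μ : Measure Ω} [IsProbabilityMeasure μ]
  {p : Fin K → Fin l → ℝ} {X : Fin K → ℕ → Ω → Fin l} {π : Scheme K l}

/-- The risk of each arm exceeds `√(2 / π) C / √n` by `O(√(log n) / n)`. -/
lemma IsSampling.integral_distL1_run_tracking_le (hX : IsSampling μ p X)
    (hp0 : ∀ i j, 0 ≤ p i j) (hp1 : ∀ i j, p i j ≤ 1) {L : ℝ}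
    (hL : ∀ x y, |steinDeriv y - steinDeriv x| ≤ L * |y - x|) (hL0 : 0 ≤ L) {n : ℕ}
    (hπ : IsOptimisticTracking π n (1 / (n : ℝ))) (hK : 0 < K) (hl : 0 < l) (hKn : K ≤ n)
    (hn : 2 ≤ n) {lam₀ : ℝ} (hlam₀ : 0 < lam₀) (hlam : lam₀ ≤ lamMin p) (hn2 : 2 ≤ lam₀ * n)
    (i : Fin K) :
    ∫ ω, distL1 (empirical (run π n X ω n) i) (p i) ∂μ
      ≤ gaussMean * (cNorm p / √n) + (2 * K * l ^ 2
        + (7 * gaussMean * excess K l lam₀ / lam₀ * √(Real.log n) + 4 * (l * (2 * L)) / lam₀)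
        + shareBound K l lam₀ ^ 2 * (gaussMean * (excess K l lam₀ * √(Real.log n))
          + l * (2 * L))) / n := by
  have hC := cNorm_pos hK hlam₀ hlam
  have ha := gaussMean_pos
  have hn0 : (0 : ℝ) < n := by positivity
  have hsn : 0 < √(n : ℝ) := Real.sqrt_pos.2 hn0
  have hsn2 : √(n : ℝ) * √n = n := Real.mul_self_sqrt hn0.le
  have hl' : (0 : ℝ) < l := by exact_mod_cast hl
  have hK' : (0 : ℝ) < K := by exact_mod_cast hK
  have hD0 : 0 < allocDev K l lam₀ := by
    have : 0 < ucbDev K l := by unfold ucbDev; positivity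
    unfold allocDev; positivity
  have hY0 : 0 < shareBound K l lam₀ := by unfold shareBound; positivity
  have hE0 : 0 < excess K l lam₀ := by unfold excess; positivity
  have hlami : ∀ i, lam₀ ≤ lam p i := fun i => hlam.trans (lamMin_le p i)
  set r := √(Real.log n) with hr
  have hr0 : 0 < r := lt_of_lt_of_le (by norm_num) (half_le_sqrt_log hn)
  set E := excess K l lam₀
  set Y := shareBound K l lam₀
  set a := gaussMean
  set C := cNorm p
  set B := (l : ℝ) * (2 * L) with hB
  have hB0 : 0 ≤ B := by positivity
  have hCn : 0 < C / √n := by positivity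
  -- `η` is the excess relative to the main term `C / √n`. It need not be small, as `C` can be
  -- arbitrarily close to 0.
  set η := E * (r / n) / (C / √n) with hηdef
  have hη0 : 0 ≤ η := by positivity
  have hη : C / √n * η = E * (r / n) := by rw [hηdef]; field_simp
  have halloc : ∀ ω ∈ goodEvent p X n, ∀ i, (n : ℝ) ≤ Y ^ 2 * pulls (run π n X ω n) i ∧
      cParam (p i) / √(pulls (run π n X ω n) i : ℝ) ≤ C / √n * (1 + η) := by
    intro ω hω i
    have h := hπ.allocation_bounds hK hl hKn hn hlam₀ hlam hn2 hp0 hp1 hω i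
    refine ⟨h.1, h.2.trans (le_of_eq ?_)⟩
    rw [mul_add, mul_one, hη]
  have hci := cParam_eq hC i
  rcases le_total η 1 with hη1 | hη1
  · have hlmi0 : 0 < lam p i := hlam₀.trans_le (hlami i)
    have hbd : ∀ ω ∈ goodEvent p X n, lam p i * n / (1 + η) ^ 2 ≤ pulls (run π n X ω n) i ∧
        pulls (run π n X ω n) i ≤ ⌊lam p i * n + 2 * η * n⌋₊ := by
      intro ω hω
      have h := pulls_between (c := fun i => cParam (p i)) (lm := lam p)
        (T := fun i => (pulls (run π n X ω n) i : ℝ)) hC hn0 hη0 (cParam_eq hC) lam_nonneg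
        (sum_lam hC) (fun i => by exact_mod_cast hπ.one_le_pulls_run hKn X ω hKn i)
        (by exact_mod_cast sum_pulls_run π n X ω n) (fun i => (halloc ω hω i).2) i
      exact ⟨h.1, Nat.le_floor h.2⟩
    have h1 := hX.integral_distL1_run_le hp0 hp1 hL hL0 π hn i _ (by positivity) hbd
    have h2 := arm_estimate (a := a) (B := B) (C := C) (N := n) (E := E) (r := r) (η := η)
      (lm := lam p i) (lam₀ := lam₀) (m := (⌊lam p i * n + 2 * η * n⌋₊ : ℕ)) ha hB0 hC hn0 hη0 hη1
      hη hlam₀ (hlami i) (lam_le_one hC i) (Nat.floor_le (by positivity))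
    rw [hci] at h1
    have h3 : 0 ≤ Y ^ 2 * (a * (E * r) + B) / n := by positivity
    rw [add_div, add_div]
    linarith
  -- For `η ≥ 1` the main term is at most `E r / n`, so the whole risk is of error order and the
  -- crude share `T_i ≥ n / Y²` suffices.
  · have hbd : ∀ ω ∈ goodEvent p X n, n / Y ^ 2 ≤ (pulls (run π n X ω n) i : ℝ) ∧
        pulls (run π n X ω n) i ≤ n := by
      intro ω hω
      refine ⟨?_, pulls_run_le π n X ω n i⟩
      rw [div_le_iff₀ (by positivity), mul_comm]
      exact (halloc ω hω i).1
    have h1 := hX.integral_distL1_run_le hp0 hp1 hL hL0 π hn i _ (by positivity) hbd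
    have h2 : C / √n ≤ E * (r / n) := by
      rw [← hη]; exact le_mul_of_one_le_right hCn.le hη1
    have h3 : (a * cParam (p i) * √n + B) / (n / Y ^ 2) ≤ Y ^ 2 * (a * (E * r) + B) / n := by
      have h4 : cParam (p i) * √n ≤ E * r := by
        have h5 : C / √n * n = C * √n := by
          nth_rewrite 2 [← hsn2]; field_simp
        have h6 := mul_le_mul_of_nonneg_right h2 hn0.le
        have h7 : E * (r / n) * n = E * r := by field_simp
        have h8 := mul_le_mul_of_nonneg_right (cParam_le_cNorm (p := p) i) hsn.le
        linarith
      calc (a * cParam (p i) * √n + B) / (n / Y ^ 2)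
          = Y ^ 2 * (a * (cParam (p i) * √n) + B) / n := by field_simp
        _ ≤ _ := by gcongr
    have h4 : 0 ≤ (7 * a * E / lam₀ * r + 4 * B / lam₀) / n := by positivity
    have h5 : 0 ≤ a * (C / √n) := by positivity
    rw [add_div, add_div]
    linarith

end

/-- The regret is at most of the order `log n / n`, uniformly in the distributions with
`lam₀ ≤ λ_min`, for every budget `n ≥ K`. -/
theorem exists_regret_le (K l : ℕ) (hK : 0 < K) (lam₀ : ℝ) (hlam₀ : 0 < lam₀) :
    ∃ C : ℝ, ∀ (p : Fin K → Fin l → ℝ), (∀ i, p i ∈ stdSimplex ℝ (Fin l)) → lam₀ ≤ lamMin p →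
      ∀ (n : ℕ), K ≤ n → ∀ (π : Scheme K l), IsOptimisticTracking π n (1 / (n : ℝ)) →
      ∀ (Ω : Type*) [MeasurableSpace Ω] (μ : Measure Ω) [IsProbabilityMeasure μ]
        (X : Fin K → ℕ → Ω → Fin l), IsSampling μ p X →
      ∀ (g : Fin K → ℝ → ℝ), IsObjectiveExtension (gam μ p X) g →
        regret μ p X g π n ≤ C * Real.log n / n := by
  obtain ⟨L, hL0, hL⟩ := exists_steinDeriv_lipschitz
  set a := gaussMean with ha_def
  set B := (l : ℝ) * (2 * L) with hB
  set E := excess K l lam₀ with hE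
  set Y := shareBound K l lam₀ with hY
  set C₁ := 2 * K * (l : ℝ) ^ 2 + 4 * B / lam₀ + Y ^ 2 * B + (a * (K * l) + B) / lam₀
    + 2 * l / lam₀ with hC₁
  set C₂ := 7 * a * E / lam₀ + Y ^ 2 * a * E with hC₂
  -- With `r = √(log n) ≥ 1/2` one has `1 ≤ 4 r²` and `r ≤ 2 r²`, which absorbs `C₁ + C₂ r` into
  -- `log n`. The summand `2 l / lam₀` of `C₁` covers the budgets with `lam₀ n ≤ 2`.
  refine ⟨4 * C₁ + 2 * C₂, ?_⟩
  intro p hp hlam n hKn π hπ Ω _ μ _ X hX g hg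
  have hl : 0 < l := by
    rcases Nat.eq_zero_or_pos l with h | h
    · subst h
      have := (hp ⟨0, hK⟩).2
      simp at this
    · exact h
  have hp0 : ∀ i j, 0 ≤ p i j := fun i => (hp i).1
  have hp1 : ∀ i j, p i j ≤ 1 := fun i j => by
    rw [← (hp i).2]
    exact Finset.single_le_sum (fun j _ => hp0 i j) (Finset.mem_univ j)
  have ha : 0 < a := gaussMean_pos
  have hB0 : 0 ≤ B := by positivity
  have hD0 : 0 ≤ allocDev K l lam₀ := by
    have : 0 ≤ ucbDev K l := by unfold ucbDev; positivity
    unfold allocDev; positivity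
  have hY0 : 0 ≤ Y := by rw [hY]; unfold shareBound; positivity
  have hE0 : 0 ≤ E := by rw [hE]; unfold excess; positivity
  have hC₁0 : 0 ≤ C₁ := by positivity
  have hC₂0 : 0 ≤ C₂ := by positivity
  have hn1 : 1 ≤ n := hK.trans_le hKn
  have hn0 : (0 : ℝ) < n := by positivity
  have hlog0 : 0 ≤ Real.log n := Real.log_nonneg (by exact_mod_cast hn1)
  rcases Nat.lt_or_ge n 2 with hn | hn
  -- For `n = 1` the claimed bound is 0 because `log 1 = 0`, so the regret must be shown to be
  -- nonpositive exactly; `K ≤ n` leaves a single arm.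
  · have hK1 : K = 1 := by omega
    subst hK1
    exact (regret_nonpos_of_one hn1 hg).trans (by positivity)
  have hne : Nonempty (Fin K) := ⟨⟨0, hK⟩⟩
  set r := √(Real.log n) with hr
  have hr1 : 1 / 2 ≤ r := half_le_sqrt_log hn
  have hr2 : r ^ 2 = Real.log n := Real.sq_sqrt hlog0
  have horacle := hX.le_oracleRisk hL hL0 hK hlam₀ hlam hn1 hg
  have hCn : 0 ≤ a * (cNorm p / √n) := by
    have := cNorm_pos hK hlam₀ hlam
    positivity
  have hrisk : risk μ p X π n ≤ a * (cNorm p / √n)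
      + (2 * K * (l : ℝ) ^ 2 + 4 * B / lam₀ + Y ^ 2 * B + 2 * l / lam₀ + C₂ * r) / n := by
    refine ciSup_le fun i => ?_
    rcases le_total 2 (lam₀ * n) with hn2 | hn2
    · refine (hX.integral_distL1_run_tracking_le hp0 hp1 hL hL0 hπ hK hl hKn hn hlam₀ hlam hn2
        i).trans (add_le_add le_rfl (div_le_div_of_nonneg_right ?_ hn0.le))
      have h1 : 0 ≤ 2 * l / lam₀ := by positivity
      have h2 : C₂ * r = 7 * a * E / lam₀ * r + Y ^ 2 * (a * (E * r)) := by rw [hC₂]; ring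
      rw [h2, mul_add (Y ^ 2)]
      linarith
    · have h1 : ∫ ω, distL1 (empirical (run π n X ω n) i) (p i) ∂μ ≤ l := by
        have h2 : ∫ ω, distL1 (empirical (run π n X ω n) i) (p i) ∂μ ≤ ∫ _ω, (l : ℝ) ∂μ :=
          integral_mono_of_nonneg (Filter.Eventually.of_forall fun ω => distL1_nonneg _ _)
            (integrable_const _) (Filter.Eventually.of_forall fun ω => by
              simp only [empirical_run]
              exact distL1_empDraws_le hp0 hp1 i _ ω)
        simpa using h2
      have h3 : (l : ℝ) ≤ 2 * l / lam₀ / n := by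
        rw [div_div, le_div_iff₀ (by positivity)]
        have : (0 : ℝ) ≤ l := Nat.cast_nonneg l
        nlinarith
      have h4 : 2 * l / lam₀ / n
          ≤ (2 * K * (l : ℝ) ^ 2 + 4 * B / lam₀ + Y ^ 2 * B + 2 * l / lam₀ + C₂ * r) / n := by
        refine div_le_div_of_nonneg_right ?_ hn0.le
        have h5 : 0 ≤ 2 * K * (l : ℝ) ^ 2 + 4 * B / lam₀ + Y ^ 2 * B + C₂ * r := by positivity
        linarith
      linarith
  have hfin : regret μ p X g π n ≤ (C₁ + C₂ * r) / n := by
    have e : (C₁ + C₂ * r) / n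
        = (2 * K * (l : ℝ) ^ 2 + 4 * B / lam₀ + Y ^ 2 * B + 2 * l / lam₀ + C₂ * r) / n
          + (a * (K * l) + B) / lam₀ / n := by rw [hC₁]; ring
    rw [regret, e]
    linarith
  refine hfin.trans (div_le_div_of_nonneg_right ?_ hn0.le)
  rw [← hr2]
  have h1 : 1 ≤ 4 * r ^ 2 := by nlinarith
  have h2 : r ≤ 2 * r ^ 2 := by nlinarith
  have h3 := mul_le_mul_of_nonneg_left h1 hC₁0
  have h4 := mul_le_mul_of_nonneg_left h2 hC₂0
  linarith

end AllocL1

end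

theorem mainTheorem3 (K l : ℕ) (hK : 0 < K) (lam₀ : ℝ) (hlam₀ : 0 < lam₀) :
    ∃ (C : ℝ) (k : ℕ),
      ∀ (p : Fin K → Fin l → ℝ), (∀ i, p i ∈ stdSimplex ℝ (Fin l)) → lam₀ ≤ AllocL1.lamMin p →
      ∀ (n : ℕ), K ≤ n →
        6 * ((K : ℝ) - 1) * AllocL1.mConst p n (1 / (n : ℝ)) ^ 2 / AllocL1.lamMin p ^ 3 ≤ (n : ℝ) →
      ∀ (π : AllocL1.Scheme K l), AllocL1.IsOptimisticTracking π n (1 / (n : ℝ)) →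
      ∀ (Ω : Type*) [MeasurableSpace Ω] (μ : MeasureTheory.Measure Ω)
        [MeasureTheory.IsProbabilityMeasure μ] (X : Fin K → ℕ → Ω → Fin l),
        AllocL1.IsSampling μ p X →
      ∀ (g : Fin K → ℝ → ℝ), AllocL1.IsObjectiveExtension (AllocL1.gam μ p X) g →
        AllocL1.regret μ p X g π n
          ≤ (l : ℝ) * √(((K : ℝ) + 5) * AllocL1.mConst p n (1 / (n : ℝ)))
                / (2 * AllocL1.lamMin p * (n : ℝ) ^ (3 / 4 : ℝ))
            + C * Real.log (n : ℝ) ^ k / (n : ℝ) := by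
  obtain ⟨C, hC⟩ := AllocL1.exists_regret_le K l hK lam₀ hlam₀
  refine ⟨C, 1, ?_⟩
  intro p hp hlam n hKn _ π hπ Ω _ μ _ X hX g hg
  have h := hC p hp hlam n hKn π hπ Ω μ X hX g hg
  have hmin : 0 < AllocL1.lamMin p := hlam₀.trans_le hlam
  -- The leading term enters only through its sign: the `log n / n` bound already dominates the
  -- regret.
  have h0 : 0 ≤ (l : ℝ) * √(((K : ℝ) + 5) * AllocL1.mConst p n (1 / (n : ℝ)))
      / (2 * AllocL1.lamMin p * (n : ℝ) ^ (3 / 4 : ℝ)) := by positivity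
  rw [pow_one]
  linarith
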